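/- Let $\mathbb F$ be an algebraically closed field of characteristic zero and let $0\neq q\in\mathbb F$ be not a root of unity. Write $[3]_q=(q^3-q^{-3})/(q-q^{-1})$. The $q$-Onsager algebra $\mathcal O_q$ is the associative unital $\mathbb F$-algebra with generators $A,B$ and relations $$A^3B-[3]_qA^2BA+[3]_qABA^2-BA^3=(q^2-q^{-2})^2(BA-AB),$$ $$B^3A-[3]_qB^2AB+[3]_qBAB^2-AB^3=(q^2-q^{-2})^2(AB-BA).$$ There are unique algebra automorphisms $T_0,T_1$ of $\mathcal O_q$ (the Baseilhac–Kolb automorphisms) with $$T_0(A)=A,\qquad T_0(B)=B+\frac{qA^2B-(q+q^{-1})ABA+q^{-1}BA^2}{(q-q^{-1})(q^2-q^{-2})},$$ $$T_1(B)=B,\qquad T_1(A)=A+\frac{qB^2A-(q+q^{-1})BAB+q^{-1}AB^2}{(q-q^{-1})(q^2-q^{-2})}.$$ Let $G$ be the subgroup of $\operatorname{Aut}(\mathcal O_q)$ generated by $T_0^{\pm1},T_1^{\pm1}$. The universal Askey–Wilson algebra $\Delta_q$ is the associative unital $\mathbb F$-algebra with generators $A,B,C$ and the relations asserting that the three elements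 $$\frac{\alpha}{q+q^{-1}}=A+\frac{qBC-q^{-1}CB}{q^2-q^{-2}},\quad \frac{\beta}{q+q^{-1}}=B+\frac{qCA-q^{-1}AC}{q^2-q^{-2}},\quad \frac{\gamma}{q+q^{-1}}=C+\frac{qAB-q^{-1}BA}{q^2-q^{-2}}$$ are central. Let $\rho,\sigma\in\mathrm{PSL}_2(\mathbb Z)$ be the classes of $\begin{pmatrix}0&-1\\1&1\end{pmatrix}$ and $\begin{pmatrix}0&-1\\1&0\end{pmatrix}$. There is a unique action of $\mathrm{PSL}_2(\mathbb Z)$ on $\Delta_q$ by algebra automorphisms such that $\rho$ sends $A\mapsto B$, $B\mapsto C$, $C\mapsto A$ and $\sigma$ sends $A\mapsto B$, $B\mapsto A$, $C\mapsto C+\frac{AB-BA}{q-q^{-1}}$. Under this action $\rho$ sends $\alpha\mapsto\beta\mapsto\gamma\mapsto\alpha$, while $\sigma$ swaps $\alpha,\beta$ and fixes $\gamma$; let $\mathbb P$ be the subgroup of $\mathrm{PSL}_2(\mathbb Z)$ consisting of the elements that fix each of $\alpha,\beta,\gamma$. Let $t_0=(\rho^2\sigma)^2$ and $t_1=(\sigma\rho^2)^2$.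 Then: 1. $G$ is freely generated by $T_0,T_1$. 2. $\mathbb P$ is the image in $\mathrm{PSL}_2(\mathbb Z)$ of the principal congruence subgroup $\Gamma(2)\subset\mathrm{SL}_2(\mathbb Z)$; the elements $t_0,t_1$ lie in $\mathbb P$, and $\mathbb P$ is freely generated by them. 3. The group homomorphism $\varepsilon\colon\mathbb P\to G$ with $t_0\mapsto T_0$, $t_1\mapsto T_1$ is an isomorphism. -/

import Mathlib

open scoped MatrixGroups

namespace QOnsager

/-- The `q`-integer `[n]_q = (q^n - q^{-n}) / (q - q^{-1})`. -/
noncomputable def qInt {F : Type*} [Field F] (q : F) (n : ℤ) : F :=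
  (q ^ n - q ^ (-n)) / (q - q⁻¹)

/-- The difference of the two sides of the `q`-Dolan/Grady relation
`X³Y - [3]_q X²YX + [3]_q XYX² - YX³ = (q² - q⁻²)² (YX - XY)`. -/
noncomputable def dolanGrady {F : Type*} [Field F] (q : F) {R : Type*} [Ring R] [Algebra F R] (X Y : R) : R :=
  (X ^ 3 * Y - qInt q 3 • (X ^ 2 * Y * X) + qInt q 3 • (X * Y * X ^ 2) - Y * X ^ 3)
    - (q ^ 2 - q⁻¹ ^ 2) ^ 2 • (Y * X - X * Y)

/-- The defining relations of the `q`-Onsager algebra, in the free algebra on two generators. -/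
inductive OnsagerRel {F : Type*} [Field F] (q : F) :
    FreeAlgebra F (Fin 2) → FreeAlgebra F (Fin 2) → Prop
  | dg₁ : OnsagerRel q (dolanGrady q (FreeAlgebra.ι F 0) (FreeAlgebra.ι F 1)) 0
  | dg₂ : OnsagerRel q (dolanGrady q (FreeAlgebra.ι F 1) (FreeAlgebra.ι F 0)) 0

/-- The `q`-Onsager algebra `O_q`. -/
noncomputable def Onsager {F : Type*} [Field F] (q : F) : Type _ :=
  RingQuot (OnsagerRel q)

noncomputable instance {F : Type*} [Field F] (q : F) : Ring (Onsager q) :=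
  inferInstanceAs (Ring (RingQuot (OnsagerRel q)))

noncomputable instance {F : Type*} [Field F] (q : F) : Algebra F (Onsager q) :=
  inferInstanceAs (Algebra F (RingQuot (OnsagerRel q)))

/-- The quotient map from the free algebra onto `O_q`. -/
noncomputable def Onsager.mk {F : Type*} [Field F] (q : F) :
    FreeAlgebra F (Fin 2) →ₐ[F] Onsager q :=
  RingQuot.mkAlgHom F (OnsagerRel q)

/-- The generator `A` of `O_q`. -/
noncomputable def Onsager.A {F : Type*} [Field F] (q : F) : Onsager q :=
  Onsager.mk q (FreeAlgebra.ι F 0)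

/-- The generator `B` of `O_q`. -/
noncomputable def Onsager.B {F : Type*} [Field F] (q : F) : Onsager q :=
  Onsager.mk q (FreeAlgebra.ι F 1)

/-- `Y + (q X²Y - (q + q⁻¹) XYX + q⁻¹ YX²) / ((q - q⁻¹)(q² - q⁻²))`. -/
noncomputable def bkImage {F : Type*} [Field F] (q : F) {R : Type*} [Ring R] [Algebra F R] (X Y : R) : R :=
  Y + ((q - q⁻¹) * (q ^ 2 - q⁻¹ ^ 2))⁻¹ •
    (q • (X ^ 2 * Y) - (q + q⁻¹) • (X * Y * X) + q⁻¹ • (Y * X ^ 2))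

/-- `T₀`, `T₁` are the Baseilhac-Kolb automorphisms of `O_q`. -/
structure IsBaseilhacKolb {F : Type*} [Field F] (q : F)
    (T₀ T₁ : Onsager q ≃ₐ[F] Onsager q) : Prop where
  T₀_A : T₀ (Onsager.A q) = Onsager.A q
  T₀_B : T₀ (Onsager.B q) = bkImage q (Onsager.A q) (Onsager.B q)
  T₁_B : T₁ (Onsager.B q) = Onsager.B q
  T₁_A : T₁ (Onsager.A q) = bkImage q (Onsager.B q) (Onsager.A q)

/-- The group `G`: the subgroup of `Aut(O_q)` generated by `T₀^{±1}`, `T₁^{±1}`. -/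
noncomputable def bkGroup {F : Type*} [Field F] {q : F} (T₀ T₁ : Onsager q ≃ₐ[F] Onsager q) :
    Subgroup (Onsager q ≃ₐ[F] Onsager q) :=
  Subgroup.closure {T₀, T₀⁻¹, T₁, T₁⁻¹}

/-- `X + (q YZ - q⁻¹ ZY) / (q² - q⁻²)`. -/
noncomputable def awElement {F : Type*} [Field F] (q : F) {R : Type*} [Ring R] [Algebra F R] (X Y Z : R) : R :=
  X + (q ^ 2 - q⁻¹ ^ 2)⁻¹ • (q • (Y * Z) - q⁻¹ • (Z * Y))

/-- The defining relations of the universal Askey-Wilson algebra, in the free algebra on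
`A = ι 0`, `B = ι 1`, `C = ι 2`: three elements are central. -/
inductive AskeyWilsonRel {F : Type*} [Field F] (q : F) :
    FreeAlgebra F (Fin 3) → FreeAlgebra F (Fin 3) → Prop
  | central_A (x : FreeAlgebra F (Fin 3)) : AskeyWilsonRel q
      (awElement q (FreeAlgebra.ι F 0) (FreeAlgebra.ι F 1) (FreeAlgebra.ι F 2) * x)
      (x * awElement q (FreeAlgebra.ι F 0) (FreeAlgebra.ι F 1) (FreeAlgebra.ι F 2))
  | central_B (x : FreeAlgebra F (Fin 3)) : AskeyWilsonRel q
      (awElement q (FreeAlgebra.ι F 1) (FreeAlgebra.ι F 2) (FreeAlgebra.ι F 0) * x)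
      (x * awElement q (FreeAlgebra.ι F 1) (FreeAlgebra.ι F 2) (FreeAlgebra.ι F 0))
  | central_C (x : FreeAlgebra F (Fin 3)) : AskeyWilsonRel q
      (awElement q (FreeAlgebra.ι F 2) (FreeAlgebra.ι F 0) (FreeAlgebra.ι F 1) * x)
      (x * awElement q (FreeAlgebra.ι F 2) (FreeAlgebra.ι F 0) (FreeAlgebra.ι F 1))

/-- The universal Askey-Wilson algebra `Δ_q`. -/
noncomputable def AskeyWilson {F : Type*} [Field F] (q : F) : Type _ :=
  RingQuot (AskeyWilsonRel q)

noncomputable instance {F : Type*} [Field F] (q : F) : Ring (AskeyWilson q) :=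
  inferInstanceAs (Ring (RingQuot (AskeyWilsonRel q)))

noncomputable instance {F : Type*} [Field F] (q : F) : Algebra F (AskeyWilson q) :=
  inferInstanceAs (Algebra F (RingQuot (AskeyWilsonRel q)))

namespace AskeyWilson

/-- The quotient map from the free algebra onto `Δ_q`. -/
noncomputable def mk {F : Type*} [Field F] (q : F) : FreeAlgebra F (Fin 3) →ₐ[F] AskeyWilson q :=
  RingQuot.mkAlgHom F (AskeyWilsonRel q)

/-- The generator `A` of `Δ_q`. -/
noncomputable def A {F : Type*} [Field F] (q : F) : AskeyWilson q := mk q (FreeAlgebra.ι F 0)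

/-- The generator `B` of `Δ_q`. -/
noncomputable def B {F : Type*} [Field F] (q : F) : AskeyWilson q := mk q (FreeAlgebra.ι F 1)

/-- The generator `C` of `Δ_q`. -/
noncomputable def C {F : Type*} [Field F] (q : F) : AskeyWilson q := mk q (FreeAlgebra.ι F 2)

/-- The central element `α` of `Δ_q`. -/
noncomputable def α {F : Type*} [Field F] (q : F) : AskeyWilson q :=
  (q + q⁻¹) • awElement q (A q) (B q) (C q)

/-- The central element `β` of `Δ_q`. -/
noncomputable def β {F : Type*} [Field F] (q : F) : AskeyWilson q :=
  (q + q⁻¹) • awElement q (B q) (C q) (A q)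

/-- The central element `γ` of `Δ_q`. -/
noncomputable def γ {F : Type*} [Field F] (q : F) : AskeyWilson q :=
  (q + q⁻¹) • awElement q (C q) (A q) (B q)

end AskeyWilson

/-- The matrix `!![0, -1; 1, 1]` in `SL₂(ℤ)`. -/
def ρMat : SL(2, ℤ) := ⟨!![0, -1; 1, 1], by simp [Matrix.det_fin_two]⟩

/-- The matrix `!![0, -1; 1, 0]` in `SL₂(ℤ)`. -/
def σMat : SL(2, ℤ) := ⟨!![0, -1; 1, 0], by simp [Matrix.det_fin_two]⟩

/-- The generator `ρ` of `PSL₂(ℤ)`, of order `3`. -/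
def ρ : PSL(2, ℤ) := QuotientGroup.mk ρMat

/-- The generator `σ` of `PSL₂(ℤ)`, of order `2`. -/
def σ : PSL(2, ℤ) := QuotientGroup.mk σMat

/-- `t₀ = (ρ²σ)²`. -/
def t₀ : PSL(2, ℤ) := (ρ ^ 2 * σ) ^ 2

/-- `t₁ = (σρ²)²`. -/
def t₁ : PSL(2, ℤ) := (σ * ρ ^ 2) ^ 2

/-- `Φ` is the action of `PSL₂(ℤ)` on `Δ_q` by automorphisms, given on the generators. -/
structure IsModularAction {F : Type*} [Field F] (q : F)
    (Φ : PSL(2, ℤ) →* (AskeyWilson q ≃ₐ[F] AskeyWilson q)) : Prop where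
  ρ_A : Φ ρ (AskeyWilson.A q) = AskeyWilson.B q
  ρ_B : Φ ρ (AskeyWilson.B q) = AskeyWilson.C q
  ρ_C : Φ ρ (AskeyWilson.C q) = AskeyWilson.A q
  σ_A : Φ σ (AskeyWilson.A q) = AskeyWilson.B q
  σ_B : Φ σ (AskeyWilson.B q) = AskeyWilson.A q
  σ_C : Φ σ (AskeyWilson.C q) = AskeyWilson.C q + (q - q⁻¹)⁻¹ •
    (AskeyWilson.A q * AskeyWilson.B q - AskeyWilson.B q * AskeyWilson.A q)

/-- The group `ℙ`: the kernel of the action of `PSL₂(ℤ)` on the set `{α, β, γ}`. -/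
noncomputable def modularKernel {F : Type*} [Field F] {q : F}
    (Φ : PSL(2, ℤ) →* (AskeyWilson q ≃ₐ[F] AskeyWilson q)) : Subgroup PSL(2, ℤ) :=
  (fixingSubgroup (AskeyWilson q ≃ₐ[F] AskeyWilson q)
    {AskeyWilson.α q, AskeyWilson.β q, AskeyWilson.γ q}).comap Φ

end QOnsager

/-! Freeness of `G` is read off from the quantum torus, spanned by `X_w` for `w ∈ ℤ²` with `X_w X_w'
= q^{symp w w'} X_{w+w'}`. The elements `E_w = X_w + X_{-w}` for `w = (1,0)` and `w = (0,1)` satisfy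
the q-Dolan/Grady relations (`dolanGrady_torusE`), so they give a representation of `O_q`. In it
`T₀` and `T₁` act as the lattice maps `U (-2)` and `L 2` (`bkImage_torusE`), which are lifts of `t₀`
and `t₁` to `SL₂(ℤ)`. A word in `T₀, T₁` that equals `1` therefore yields a matrix fixing `(1,0)`
and `(0,1)` up to sign. Its determinant being 1, the matrix is `±1`, so the same word in `t₀, t₁` is
trivial in `PSL₂(ℤ)`. There `t₀, t₁` are free by ping-pong (`lift_t₀_t₁_injective`), so the word is
empty. The representation need not be faithful. The isomorphism `ε` then matches two free bases.

For `ℙ`, the action on `α, β, γ` is that of `SL₂(ℤ/2)` on the nonzero vectors of `(ℤ/2)²`, so the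
kernel is the image of `Γ(2)`. A Euclidean algorithm with even quotients shows that `t₀, t₁`
generate it.

The existence of `T₀` is the computational part. Left and right multiplication by `A` commute, so
expressions linear in `B` are polynomials in two commuting variables, and expressions cubic in `B`
are polynomials in four: one for each gap around the three copies of `B`. The relations become
identities of commutative polynomials, the hard one being `bkShadow_mul_bkShadow_mul_bkShadow`. The
action on `Δ_q` exists because `PSL₂(ℤ)` is the free product of cyclic groups of orders 3 and 2,
again by ping-pong. -/

namespace QOnsager

open MvPolynomial

/-! ### Noncommutative words as commutative polynomials in the positions of `A` -/

section Braid

variable {F : Type*} [Field F] {R : Type*} [Ring R] [Algebra F R]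

/-- `f(l, r) Y`, where `l` and `r` are left and right multiplication by `A`. -/
noncomputable def bimodEval (A Y : R) : MvPolynomial (Fin 2) F →ₗ[F] R :=
  (basisMonomials (Fin 2) F).constr F fun m => A ^ m 0 * Y * A ^ m 1

/-- The linear map sending `a₀ⁱ a₁ʲ a₂ᵏ a₃ˡ` to `Aⁱ Y₁ Aʲ Y₂ Aᵏ Y₃ Aˡ`. -/
noncomputable def insertEval (A Y₁ Y₂ Y₃ : R) : MvPolynomial (Fin 4) F →ₗ[F] R :=
  (basisMonomials (Fin 4) F).constr F fun m =>
    A ^ m 0 * Y₁ * A ^ m 1 * Y₂ * A ^ m 2 * Y₃ * A ^ m 3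

theorem bimodEval_monomial (A Y : R) (m : Fin 2 →₀ ℕ) (c : F) :
    bimodEval A Y (monomial m c) = c • (A ^ m 0 * Y * A ^ m 1) := by
  have h : monomial m c = c • basisMonomials (Fin 2) F m := by
    simp [smul_monomial]
  rw [h, map_smul, bimodEval, Module.Basis.constr_basis]

theorem insertEval_monomial (A Y₁ Y₂ Y₃ : R) (m : Fin 4 →₀ ℕ) (c : F) :
    insertEval A Y₁ Y₂ Y₃ (monomial m c) =
      c • (A ^ m 0 * Y₁ * A ^ m 1 * Y₂ * A ^ m 2 * Y₃ * A ^ m 3) := by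
  have h : monomial m c = c • basisMonomials (Fin 4) F m := by
    simp [smul_monomial]
  rw [h, map_smul, insertEval, Module.Basis.constr_basis]

theorem bimodEval_C_mul_X_pow_mul_X_pow (A Y : R) (c : F) (i j : ℕ) :
    bimodEval A Y (C c * X 0 ^ i * X 1 ^ j) = c • (A ^ i * Y * A ^ j) := by
  have h : (C c * X 0 ^ i * X 1 ^ j : MvPolynomial (Fin 2) F) =
      monomial (Finsupp.single 0 i + Finsupp.single 1 j) c := by
    rw [X_pow_eq_monomial, X_pow_eq_monomial, C_mul_monomial, monomial_mul, mul_one, mul_one]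
  rw [h, bimodEval_monomial]
  simp

theorem insertEval_C_mul_X (A Y₁ Y₂ Y₃ : R) (c : F) (i : Fin 4) :
    insertEval A Y₁ Y₂ Y₃ (C c * X i) =
      c • (A ^ (Finsupp.single i 1 0) * Y₁ * A ^ (Finsupp.single i 1 1) * Y₂ *
        A ^ (Finsupp.single i 1 2) * Y₃ * A ^ (Finsupp.single i 1 3)) := by
  rw [X, C_mul_monomial, mul_one, insertEval_monomial]

/-- Left and right multiplications by `A` commute, so operators built from them compose as
polynomials multiply. -/
theorem bimodEval_mul (A Y : R) (f g : MvPolynomial (Fin 2) F) :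
    bimodEval A (bimodEval A Y f) g = bimodEval A Y (g * f) := by
  induction g using MvPolynomial.induction_on' with
  | add p q hp hq => rw [map_add, hp, hq, add_mul, map_add]
  | monomial m c =>
    induction f using MvPolynomial.induction_on' with
    | add p q hp hq =>
      rw [mul_add, map_add, map_add, ← hp, ← hq, bimodEval_monomial, bimodEval_monomial,
        bimodEval_monomial]
      simp only [mul_add, add_mul, smul_add]
    | monomial m' c' =>
      rw [monomial_mul, bimodEval_monomial, bimodEval_monomial, bimodEval_monomial]
      simp only [Finsupp.add_apply, mul_smul_comm, smul_mul_assoc, smul_smul]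
      rw [pow_add, add_comm (m 1), pow_add]
      simp only [mul_assoc]

theorem mapDomain_two_four {i j : Fin 4} (m : Fin 2 →₀ ℕ) :
    Finsupp.mapDomain ![i, j] m = Finsupp.single i (m 0) + Finsupp.single j (m 1) := by
  have h : m = Finsupp.single 0 (m 0) + Finsupp.single 1 (m 1) := by
    ext k; fin_cases k <;> simp
  conv_lhs => rw [h]
  simp [Finsupp.mapDomain_add, Finsupp.mapDomain_single]

/-- The gaps adjacent to `Y₁` are numbers 0 and 1, so an operator applied to `Y₁` multiplies by a
polynomial in these two variables. The next two lemmas do the same for the other factors. -/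
theorem insertEval_bimodEval_left (A Y₁ Y₂ Y₃ : R) (f : MvPolynomial (Fin 2) F)
    (g : MvPolynomial (Fin 4) F) :
    insertEval A (bimodEval A Y₁ f) Y₂ Y₃ g =
      insertEval A Y₁ Y₂ Y₃ (rename ![0, 1] f * g) := by
  induction g using MvPolynomial.induction_on' with
  | add p q hp hq => rw [map_add, hp, hq, mul_add, map_add]
  | monomial m c =>
    induction f using MvPolynomial.induction_on' with
    | add p q hp hq =>
      rw [map_add, map_add, add_mul, map_add, ← hp, ← hq]
      simp only [insertEval_monomial, mul_add, add_mul, smul_add]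
    | monomial m' c' =>
      rw [rename_monomial, mapDomain_two_four, monomial_mul, bimodEval_monomial,
        insertEval_monomial, insertEval_monomial]
      simp [add_comm (m' 0) (m 0), smul_smul, pow_add, mul_assoc, mul_comm c]

theorem insertEval_bimodEval_middle (A Y₁ Y₂ Y₃ : R) (f : MvPolynomial (Fin 2) F)
    (g : MvPolynomial (Fin 4) F) :
    insertEval A Y₁ (bimodEval A Y₂ f) Y₃ g =
      insertEval A Y₁ Y₂ Y₃ (rename ![1, 2] f * g) := by
  induction g using MvPolynomial.induction_on' with
  | add p q hp hq => rw [map_add, hp, hq, mul_add, map_add]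
  | monomial m c =>
    induction f using MvPolynomial.induction_on' with
    | add p q hp hq =>
      rw [map_add, map_add, add_mul, map_add, ← hp, ← hq]
      simp only [insertEval_monomial, mul_add, add_mul, smul_add]
    | monomial m' c' =>
      rw [rename_monomial, mapDomain_two_four, monomial_mul, bimodEval_monomial,
        insertEval_monomial, insertEval_monomial]
      simp [add_comm (m' 0) (m 1), smul_smul, pow_add, mul_assoc, mul_comm c]

theorem insertEval_bimodEval_right (A Y₁ Y₂ Y₃ : R) (f : MvPolynomial (Fin 2) F)
    (g : MvPolynomial (Fin 4) F) :
    insertEval A Y₁ Y₂ (bimodEval A Y₃ f) g =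
      insertEval A Y₁ Y₂ Y₃ (rename ![2, 3] f * g) := by
  induction g using MvPolynomial.induction_on' with
  | add p q hp hq => rw [map_add, hp, hq, mul_add, map_add]
  | monomial m c =>
    induction f using MvPolynomial.induction_on' with
    | add p q hp hq =>
      rw [map_add, map_add, add_mul, map_add, ← hp, ← hq]
      simp only [insertEval_monomial, mul_add, add_mul, smul_add]
    | monomial m' c' =>
      rw [rename_monomial, mapDomain_two_four, monomial_mul, bimodEval_monomial,
        insertEval_monomial, insertEval_monomial]
      simp [add_comm (m' 0) (m 2), smul_smul, pow_add, mul_assoc, mul_comm c]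

/-- Multiplying the whole word by `A` from outside only affects the first and last gaps, 0 and 3. -/
theorem bimodEval_insertEval (A Y₁ Y₂ Y₃ : R) (f : MvPolynomial (Fin 2) F)
    (g : MvPolynomial (Fin 4) F) :
    bimodEval A (insertEval A Y₁ Y₂ Y₃ g) f =
      insertEval A Y₁ Y₂ Y₃ (rename ![0, 3] f * g) := by
  induction f using MvPolynomial.induction_on' with
  | add p q hp hq => rw [map_add, hp, hq, map_add, add_mul, map_add]
  | monomial m' c' =>
    induction g using MvPolynomial.induction_on' with
    | add p q hp hq =>
      rw [map_add, mul_add, map_add, ← hp, ← hq]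
      simp only [bimodEval_monomial, mul_add, add_mul, smul_add]
    | monomial m c =>
      rw [rename_monomial, mapDomain_two_four, monomial_mul, bimodEval_monomial,
        insertEval_monomial, insertEval_monomial]
      simp [add_comm (m' 1) (m 3), smul_smul, pow_add, mul_assoc]

end Braid
end QOnsager

namespace QOnsager

/-! ### The polynomial identity behind the second relation -/

section Certificate

variable {S : Type*} [CommRing S]

/-- The commutative shadow of the `q`-Dolan/Grady relation, scaled by `z²` where `z = q²`. -/
def dgShadow (z a b : S) : S :=
  (a - b) * (z ^ 2 * a ^ 2 - (z ^ 3 + z) * (a * b) + z ^ 2 * b ^ 2 + (z ^ 2 - 1) ^ 2)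

/-- The commutative shadow of `bkImage`, scaled by `(z - 1) (z² - 1)` where `z = q²`. -/
def bkShadow (z a b : S) : S :=
  (z - 1) * (z ^ 2 - 1) + (a - b) * z * (z * a - b)

/-- The coefficient of `dgShadow z a0 a1` in `bkShadow_mul_bkShadow_mul_bkShadow`. -/
def bkCofactor₁ (z a0 a1 a2 a3 : S) : S :=
  let n₂ := z ^ 2 + 1
  let n₃ := z ^ 2 + z + 1
  z ^ 2 * (z - 1) ^ 2 * (z + 1) ^ 2 * n₂ * a3 ^ 2 - z * (z - 1) ^ 2 * (z + 1) ^ 2 * n₂ * n₃ *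
    a2 ^ 2 - z ^ 2 * n₂ * n₃ * a2 ^ 2 * a3 ^ 2 + z ^ 2 * (z + 1) * n₂ * n₃ * a2 ^ 3 * a3 - z ^
    3 * n₂ * n₃ * a2 ^ 4 - z ^ 3 * (z - 1) ^ 2 * (z + 1) * n₃ * a1 * a3 + z * (z - 1) ^ 2 * (z
    + 1) * n₃ * (2 * z ^ 3 + 2 * z ^ 2 + 2 * z + 1) * a1 * a2 + z ^ 2 * (z + 1) * n₂ * n₃ * a1
    * a2 * a3 ^ 2 - z ^ 2 * (z + 1) ^ 2 * n₂ * n₃ * a1 * a2 ^ 2 * a3 + z ^ 3 * (z + 1) * n₂ *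
    n₃ * a1 * a2 ^ 3 - z ^ 2 * (z - 1) ^ 2 * (z + 1) * n₃ ^ 2 * a1 ^ 2 - z ^ 3 * n₂ * n₃ * a1 ^
    2 * a3 ^ 2 + z ^ 3 * (z + 1) * n₂ * n₃ * a1 ^ 2 * a2 * a3 - z ^ 4 * n₂ * n₃ * a1 ^ 2 * a2 ^
    2 + z ^ 2 * (z - 1) ^ 2 * (z + 1) * (-z ^ 3 - 2 * z ^ 2 - z - 1) * a0 * a3 + z ^ 3 * (z -
    1) ^ 2 * (z + 1) * n₃ * a0 * a2 + z ^ 4 * (z - 1) ^ 2 * (z + 1) * a0 ^ 2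

/-- The coefficient of `dgShadow z a1 a2` in `bkShadow_mul_bkShadow_mul_bkShadow`. -/
def bkCofactor₂ (z a0 a1 a2 a3 : S) : S :=
  let n₂ := z ^ 2 + 1
  let n₃ := z ^ 2 + z + 1
  z ^ 2 * (z - 1) ^ 2 * (z + 1) ^ 2 * n₂ * a3 ^ 2 - z ^ 3 * (z - 1) ^ 2 * (z + 1) * n₃ * a2 *
    a3 + z ^ 3 * n₂ * n₃ * a2 * a3 ^ 3 - z * (z - 1) ^ 2 * (z + 1) * n₃ * a2 ^ 2 - z ^ 2 * n₂ *
    n₃ ^ 2 * a2 ^ 2 * a3 ^ 2 + z ^ 2 * n₂ * n₃ ^ 2 * a2 ^ 3 * a3 - z ^ 3 * n₂ * n₃ * a2 ^ 4 + z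
    * (z - 1) ^ 2 * (z + 1) * n₃ * a1 * a3 + z ^ 2 * n₂ * n₃ * a1 * a3 ^ 3 - (z - 1) ^ 2 * (z +
    1) * n₂ * n₃ * a1 * a2 - z * n₂ * n₃ ^ 2 * a1 * a2 * a3 ^ 2 + z * n₂ * n₃ ^ 2 * a1 * a2 ^ 2
    * a3 - z ^ 2 * n₂ * n₃ * a1 * a2 ^ 3 + (z - 1) ^ 2 * (z + 1) * n₃ ^ 2 * a1 ^ 2 + z * (z +
    1) * n₂ * n₃ * a1 ^ 2 * a3 ^ 2 - z * (z + 1) ^ 2 * n₂ * n₃ * a1 ^ 2 * a2 * a3 + z ^ 2 * (z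
    + 1) * n₂ * n₃ * a1 ^ 2 * a2 ^ 2 - z * (z - 1) ^ 2 * (z + 1) ^ 3 * n₂ * a0 * a3 - z ^ 2 *
    (z + 1) * n₂ * n₃ * a0 * a3 ^ 3 + (z - 1) ^ 2 * (z + 1) * n₃ * (2 * z ^ 3 + z ^ 2 + z + 1)
    * a0 * a2 + z * (z + 1) * n₂ * n₃ ^ 2 * a0 * a2 * a3 ^ 2 - z * (z + 1) * n₂ * n₃ ^ 2 * a0 *
    a2 ^ 2 * a3 + z ^ 2 * (z + 1) * n₂ * n₃ * a0 * a2 ^ 3 + (z - 1) ^ 2 * (z + 1) * n₃ * (-z ^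
    3 - z ^ 2 - 2 * z - 1) * a0 * a1 - z * (z + 1) ^ 2 * n₂ * n₃ * a0 * a1 * a3 ^ 2 + z * (z +
    1) ^ 3 * n₂ * n₃ * a0 * a1 * a2 * a3 - z ^ 2 * (z + 1) ^ 2 * n₂ * n₃ * a0 * a1 * a2 ^ 2 + z
    * (z - 1) ^ 2 * (z + 1) ^ 2 * n₂ * a0 ^ 2 + z ^ 2 * (z + 1) * n₂ * n₃ * a0 ^ 2 * a3 ^ 2 - z
    ^ 2 * (z + 1) ^ 2 * n₂ * n₃ * a0 ^ 2 * a2 * a3 + z ^ 3 * (z + 1) * n₂ * n₃ * a0 ^ 2 * a2 ^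
    2

/-- The coefficient of `dgShadow z a2 a3` in `bkShadow_mul_bkShadow_mul_bkShadow`. -/
def bkCofactor₃ (z a0 a1 a2 a3 : S) : S :=
  let n₂ := z ^ 2 + 1
  let n₃ := z ^ 2 + z + 1
  z ^ 2 * (z - 1) ^ 2 * (z + 1) * a3 ^ 2 + (z - 1) ^ 2 * (z + 1) * n₃ * (-z ^ 4 - z ^ 3 - 2 * z
    ^ 2 - 2 * z - 1) * a2 ^ 2 - z ^ 3 * n₂ * n₃ * a2 ^ 4 + z * (z - 1) ^ 2 * (z + 1) * n₃ * a1
    * a3 + (z - 1) ^ 2 * (z + 1) * n₃ * (z ^ 4 + z ^ 3 + 2 * z ^ 2 + 2 * z + 1) * a1 * a2 + z ^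
    3 * (z + 1) * n₂ * n₃ * a1 * a2 ^ 3 - z ^ 4 * n₂ * n₃ * a1 ^ 2 * a2 ^ 2 + z * (z - 1) ^ 2 *
    (z + 1) * (-z ^ 3 - z ^ 2 - 2 * z - 1) * a0 * a3 + (z - 1) ^ 2 * (z + 1) * n₃ * (z ^ 4 + 2
    * z ^ 3 + 2 * z ^ 2 + z + 1) * a0 * a2 + z ^ 2 * (z + 1) * n₂ * n₃ * a0 * a2 ^ 3 - (z - 1)
    ^ 2 * (z + 1) ^ 3 * n₂ * n₃ * a0 * a1 - z ^ 2 * (z + 1) ^ 2 * n₂ * n₃ * a0 * a1 * a2 ^ 2 +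
    z ^ 3 * (z + 1) * n₂ * n₃ * a0 * a1 ^ 2 * a2 + z * (z - 1) ^ 2 * (z + 1) ^ 2 * n₂ * a0 ^ 2
    - z ^ 2 * n₂ * n₃ * a0 ^ 2 * a2 ^ 2 + z ^ 2 * (z + 1) * n₂ * n₃ * a0 ^ 2 * a1 * a2 - z ^ 3
    * n₂ * n₃ * a0 ^ 2 * a1 ^ 2

set_option maxHeartbeats 4000000 in
/-- The composite of three copies of `bkShadow` along `a₀, a₁, a₂, a₃` depends only on the
endpoints, up to `dgShadow` and after multiplication by the shadow of the cubic form. -/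
theorem bkShadow_mul_bkShadow_mul_bkShadow (z a0 a1 a2 a3 : S) :
    (z * a3 - (z ^ 2 + z + 1) * a2 + (z ^ 2 + z + 1) * a1 - z * a0) *
      ((z ^ 3 - 1) * (z ^ 4 - 1) * (bkShadow z a0 a1 * bkShadow z a1 a2 * bkShadow z a2 a3) -
        ((z - 1) * (z ^ 2 - 1)) ^ 2 * ((z ^ 3 - 1) * (z ^ 4 - 1)) * bkShadow z a0 a3 -
        ((z - 1) * (z ^ 2 - 1)) ^ 2 * z ^ 2 * (z ^ 2 * a0 - a3) * dgShadow z a0 a3) =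
      z * (z - 1) ^ 2 * (z + 1) * (bkCofactor₁ z a0 a1 a2 a3 * dgShadow z a0 a1 +
        bkCofactor₂ z a0 a1 a2 a3 * dgShadow z a1 a2 +
        bkCofactor₃ z a0 a1 a2 a3 * dgShadow z a2 a3) := by
  -- Origin of the identity: write `a = t + t⁻¹`. Then `dgShadow z a b` vanishes when `b = a` or
  -- when `b` arises from `t ↦ z^{±1} t`. There `bkShadow z a b / ((z - 1)(z² - 1))` is `1` for `b =
  -- a` and `z⁻¹ t⁻²` for `t ↦ z t`; opposite shifts give inverse values. Along a path of three such
  -- steps the product therefore depends only on the endpoints. For total shift at most 1 it is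
  -- given by `bkShadow z a0 a3`; the multiple of `dgShadow z a0 a3` corrects the formula at shift
  -- `±2`; at shift `±3` the cubic form vanishes. The cofactors express this vanishing as membership
  -- in the ideal of the three `dgShadow`s.
  simp only [bkShadow, dgShadow, bkCofactor₁, bkCofactor₂, bkCofactor₃]
  ring

end Certificate

end QOnsager

namespace QOnsager

open MvPolynomial

/-! ### `bkImage` respects the q-Dolan/Grady relations -/

section BraidRelations

variable {F : Type*} [Field F] {R : Type*} [Ring R] [Algebra F R] {q : F}

theorem sq_sub_one_ne_zero (hroot : ∀ n : ℕ, 0 < n → q ^ n ≠ 1) {n : ℕ} (hn : 0 < n) :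
    (q ^ 2) ^ n - 1 ≠ 0 := by
  rw [← pow_mul]
  exact sub_ne_zero.mpr (hroot _ (by omega))

theorem sub_inv_ne_zero (hq : q ≠ 0) (hroot : ∀ n : ℕ, 0 < n → q ^ n ≠ 1) : q - q⁻¹ ≠ 0 := by
  intro h
  apply hroot 2 (by norm_num)
  field_simp at h
  linear_combination h

theorem sq_sub_inv_sq_ne_zero (hq : q ≠ 0) (hroot : ∀ n : ℕ, 0 < n → q ^ n ≠ 1) :
    q ^ 2 - q⁻¹ ^ 2 ≠ 0 := by
  intro h
  apply hroot 4 (by norm_num)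
  field_simp at h
  linear_combination h

theorem add_inv_ne_zero (hq : q ≠ 0) (hroot : ∀ n : ℕ, 0 < n → q ^ n ≠ 1) : q + q⁻¹ ≠ 0 := by
  intro h
  apply sq_sub_inv_sq_ne_zero hq hroot
  linear_combination (q - q⁻¹) * h

theorem qInt_three (hq : q ≠ 0) (hroot : ∀ n : ℕ, 0 < n → q ^ n ≠ 1) :
    qInt q 3 = q ^ 2 + 1 + q⁻¹ ^ 2 := by
  rw [qInt, div_eq_iff (sub_inv_ne_zero hq hroot), zpow_neg]
  norm_cast
  field_simp
  ring

theorem bimodEval_dgShadow (hq : q ≠ 0) (hroot : ∀ n : ℕ, 0 < n → q ^ n ≠ 1) (A Y : R) :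
    bimodEval A Y (dgShadow (C (q ^ 2)) (X 0) (X 1)) = q ^ 4 • dolanGrady q A Y := by
  have h : (dgShadow (C (q ^ 2)) (X 0) (X 1) : MvPolynomial (Fin 2) F) =
      C (q ^ 4) * X 0 ^ 3 * X 1 ^ 0 + C (-(q ^ 6 + q ^ 4 + q ^ 2)) * X 0 ^ 2 * X 1 ^ 1 +
        C (q ^ 6 + q ^ 4 + q ^ 2) * X 0 ^ 1 * X 1 ^ 2 + C (-q ^ 4) * X 0 ^ 0 * X 1 ^ 3 +
        C ((q ^ 4 - 1) ^ 2) * X 0 ^ 1 * X 1 ^ 0 + C (-(q ^ 4 - 1) ^ 2) * X 0 ^ 0 * X 1 ^ 1 := by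
    simp only [dgShadow, map_add, map_neg, map_sub, map_pow, map_one]
    ring
  have e₁ : q ^ 6 + q ^ 4 + q ^ 2 = q ^ 4 * qInt q 3 := by
    rw [qInt_three hq hroot]; field_simp
  have e₂ : (q ^ 4 - 1) ^ 2 = q ^ 4 * (q ^ 2 - q⁻¹ ^ 2) ^ 2 := by
    field_simp
  rw [h, map_add, map_add, map_add, map_add, map_add]
  simp only [bimodEval_C_mul_X_pow_mul_X_pow]
  simp only [e₁, e₂, dolanGrady, pow_zero, pow_one, one_mul, mul_one]
  module

theorem bimodEval_bkShadow (hq : q ≠ 0) (hroot : ∀ n : ℕ, 0 < n → q ^ n ≠ 1) (A Y : R) :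
    bimodEval A Y (bkShadow (C (q ^ 2)) (X 0) (X 1)) =
      ((q ^ 2 - 1) * ((q ^ 2) ^ 2 - 1)) • bkImage q A Y := by
  have h : (bkShadow (C (q ^ 2)) (X 0) (X 1) : MvPolynomial (Fin 2) F) =
      C ((q ^ 2 - 1) * ((q ^ 2) ^ 2 - 1)) * X 0 ^ 0 * X 1 ^ 0 +
        C (q ^ 4) * X 0 ^ 2 * X 1 ^ 0 + C (-(q ^ 2 + q ^ 4)) * X 0 ^ 1 * X 1 ^ 1 +
        C (q ^ 2) * X 0 ^ 0 * X 1 ^ 2 := by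
    simp only [bkShadow, map_add, map_mul, map_neg, map_sub, map_pow, map_one]
    ring
  have e : (q ^ 2 - 1) * ((q ^ 2) ^ 2 - 1) * ((q - q⁻¹) * (q ^ 2 - q⁻¹ ^ 2))⁻¹ = q ^ 3 := by
    rw [← div_eq_mul_inv, div_eq_iff
      (mul_ne_zero (sub_inv_ne_zero hq hroot) (sq_sub_inv_sq_ne_zero hq hroot))]
    field_simp
  have e₀ : q ^ 4 = q ^ 3 * q := by ring
  have e₁ : q ^ 2 + q ^ 3 * q = q ^ 3 * (q + q⁻¹) := by field_simp; ring
  have e₂ : q ^ 2 = q ^ 3 * q⁻¹ := by field_simp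
  rw [h]
  simp only [map_add, bimodEval_C_mul_X_pow_mul_X_pow, bkImage, smul_add _ Y, smul_smul, e]
  rw [e₀, e₁, show (q ^ 2 • (A ^ 0 * Y * A ^ 2) : R) = (q ^ 3 * q⁻¹) • (A ^ 0 * Y * A ^ 2) by
    rw [← e₂]]
  simp only [pow_zero, pow_one, one_mul, mul_one]
  module

/-- Inverting `q` exchanges the outer coefficients of `bkImage` and leaves its denominator
unchanged, so it amounts to exchanging left and right multiplication. -/
theorem bimodEval_bkShadow_swap (hq : q ≠ 0) (hroot : ∀ n : ℕ, 0 < n → q ^ n ≠ 1) (A Y : R) :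
    bimodEval A Y (bkShadow (C (q ^ 2)) (X 1) (X 0)) =
      ((q ^ 2 - 1) * ((q ^ 2) ^ 2 - 1)) • bkImage q⁻¹ A Y := by
  have h : (bkShadow (C (q ^ 2)) (X 1) (X 0) : MvPolynomial (Fin 2) F) =
      C ((q ^ 2 - 1) * ((q ^ 2) ^ 2 - 1)) * X 0 ^ 0 * X 1 ^ 0 +
        C (q ^ 2) * X 0 ^ 2 * X 1 ^ 0 + C (-(q ^ 2 + q ^ 4)) * X 0 ^ 1 * X 1 ^ 1 +
        C (q ^ 4) * X 0 ^ 0 * X 1 ^ 2 := by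
    simp only [bkShadow, map_add, map_mul, map_neg, map_sub, map_pow, map_one]
    ring
  have e : (q ^ 2 - 1) * ((q ^ 2) ^ 2 - 1) * ((q⁻¹ - q) * (q⁻¹ ^ 2 - q ^ 2))⁻¹ = q ^ 3 := by
    rw [show (q⁻¹ - q) * (q⁻¹ ^ 2 - q ^ 2) = (q - q⁻¹) * (q ^ 2 - q⁻¹ ^ 2) by ring,
      ← div_eq_mul_inv, div_eq_iff
      (mul_ne_zero (sub_inv_ne_zero hq hroot) (sq_sub_inv_sq_ne_zero hq hroot))]
    field_simp
  have e₀ : q ^ 4 = q ^ 3 * q := by ring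
  have e₁ : q ^ 2 + q ^ 3 * q = q ^ 3 * (q⁻¹ + q) := by field_simp
  have e₂ : q ^ 2 = q ^ 3 * q⁻¹ := by field_simp
  rw [h]
  simp only [map_add, bimodEval_C_mul_X_pow_mul_X_pow, bkImage, smul_add _ Y, smul_smul, e,
    inv_inv]
  rw [e₀, e₁, show (q ^ 2 • (A ^ 2 * Y * A ^ 0) : R) = (q ^ 3 * q⁻¹) • (A ^ 2 * Y * A ^ 0) by
    rw [← e₂]]
  simp only [pow_zero, pow_one, one_mul, mul_one]
  module

theorem bimodEval_smul (A Y : R) (a : F) (f : MvPolynomial (Fin 2) F) :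
    bimodEval A (a • Y) f = a • bimodEval A Y f := by
  induction f using MvPolynomial.induction_on' with
  | add p q hp hq => rw [map_add, hp, hq, map_add, smul_add]
  | monomial m c =>
    simp only [bimodEval_monomial, mul_smul_comm, smul_mul_assoc, smul_smul]
    congr 1; ring

theorem bimodEval_zero (A : R) (f : MvPolynomial (Fin 2) F) : bimodEval A 0 f = 0 := by
  simpa using bimodEval_smul A 0 (0 : F) f

/-- The relation with `Y` in the cubic role has a leading part linear in `A`, hence a linear form in
the four gap variables. The added commutator cancels the terms that are only linear in `Y`. -/
theorem insertEval_cubic (hq : q ≠ 0) (hroot : ∀ n : ℕ, 0 < n → q ^ n ≠ 1) (A Y : R) :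
    insertEval A Y Y Y
      (C (q ^ 2) * X 3 - (C (q ^ 2) ^ 2 + C (q ^ 2) + 1) * X 2 +
        (C (q ^ 2) ^ 2 + C (q ^ 2) + 1) * X 1 - C (q ^ 2) * X 0 : MvPolynomial (Fin 4) F) =
      q ^ 2 • (dolanGrady q Y A + (q ^ 2 - q⁻¹ ^ 2) ^ 2 • (A * Y - Y * A)) := by
  have h : (C (q ^ 2) ^ 2 + C (q ^ 2) + 1 : MvPolynomial (Fin 4) F) = C (q ^ 2 * qInt q 3) := by
    have : q ^ 2 * qInt q 3 = (q ^ 2) ^ 2 + q ^ 2 + 1 := by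
      rw [qInt_three hq hroot]; field_simp
    rw [this]; simp
  rw [h]
  simp only [map_add, map_sub, insertEval_C_mul_X, dolanGrady]
  simp [pow_succ, mul_assoc]
  module

theorem bimodEval_X_sub_X (A Y : R) :
    bimodEval A Y (X 0 - X 1 : MvPolynomial (Fin 2) F) = A * Y - Y * A := by
  have h : (X 0 - X 1 : MvPolynomial (Fin 2) F) =
      C 1 * X 0 ^ 1 * X 1 ^ 0 + C (-1) * X 0 ^ 0 * X 1 ^ 1 := by
    simp; ring
  rw [h, map_add, bimodEval_C_mul_X_pow_mul_X_pow, bimodEval_C_mul_X_pow_mul_X_pow]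
  simp [sub_eq_add_neg]

theorem bimodEval_eq_zero {A Y : R} {f : MvPolynomial (Fin 2) F} (hf : bimodEval A Y f = 0)
    (g : MvPolynomial (Fin 2) F) : bimodEval A Y (g * f) = 0 := by
  rw [← bimodEval_mul, hf, bimodEval_zero]

/-- `bkImage` preserves the first `q`-Dolan/Grady relation. -/
theorem dolanGrady_bkImage_right (hq : q ≠ 0) (hroot : ∀ n : ℕ, 0 < n → q ^ n ≠ 1) {A B : R}
    (h : dolanGrady q A B = 0) : dolanGrady q A (bkImage q A B) = 0 := by
  have hk : (q ^ 2 - 1) * ((q ^ 2) ^ 2 - 1) ≠ 0 :=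
    mul_ne_zero (by simpa using sq_sub_one_ne_zero hroot one_pos)
      (sq_sub_one_ne_zero hroot two_pos)
  have h0 : bimodEval A B (dgShadow (C (q ^ 2)) (X 0) (X 1)) = 0 := by
    rw [bimodEval_dgShadow hq hroot, h, smul_zero]
  -- Both shadows act through commuting multiplications, so the relation for `B` passes to `bkImage
  -- q A B`.
  have h1 := bimodEval_eq_zero h0 (bkShadow (C (q ^ 2)) (X 0) (X 1))
  rw [mul_comm, ← bimodEval_mul, bimodEval_bkShadow hq hroot, bimodEval_dgShadow hq hroot] at h1
  have h2 : dolanGrady q A (((q ^ 2 - 1) * ((q ^ 2) ^ 2 - 1)) • bkImage q A B) =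
      ((q ^ 2 - 1) * ((q ^ 2) ^ 2 - 1)) • dolanGrady q A (bkImage q A B) := by
    simp only [dolanGrady, mul_smul_comm, smul_mul_assoc]
    module
  rw [h2, smul_smul, smul_eq_zero] at h1
  exact h1.resolve_left (mul_ne_zero (pow_ne_zero _ hq) hk)

/-- `bkImage` preserves the second `q`-Dolan/Grady relation. -/
theorem dolanGrady_bkImage_left (hq : q ≠ 0) (hroot : ∀ n : ℕ, 0 < n → q ^ n ≠ 1) {A B : R}
    (h₁ : dolanGrady q A B = 0) (h₂ : dolanGrady q B A = 0) :
    dolanGrady q (bkImage q A B) A = 0 := by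
  set k := (q ^ 2 - 1) * ((q ^ 2) ^ 2 - 1) with hk_def
  set k' := ((q ^ 2) ^ 3 - 1) * ((q ^ 2) ^ 4 - 1) with hk'_def
  set c := (q ^ 2 - q⁻¹ ^ 2) ^ 2 with hc_def
  have hk : k ≠ 0 := mul_ne_zero (by simpa using sq_sub_one_ne_zero hroot one_pos)
      (sq_sub_one_ne_zero hroot two_pos)
  have hk' : k' ≠ 0 := mul_ne_zero (sq_sub_one_ne_zero hroot (by norm_num))
      (sq_sub_one_ne_zero hroot (by norm_num))
  have h0 : bimodEval A B (dgShadow (C (q ^ 2)) (X 0) (X 1)) = 0 := by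
    rw [bimodEval_dgShadow hq hroot, h₁, smul_zero]
  have hren : ∀ i j : Fin 4, rename ![i, j] (dgShadow (C (q ^ 2)) (X 0) (X 1)) =
      dgShadow (C (q ^ 2) : MvPolynomial (Fin 4) F) (X i) (X j) := by
    intro i j; simp [dgShadow]
  have hrenb : ∀ i j : Fin 4, rename ![i, j] (bkShadow (C (q ^ 2)) (X 0) (X 1)) =
      bkShadow (C (q ^ 2) : MvPolynomial (Fin 4) F) (X i) (X j) := by
    intro i j; simp [bkShadow]
  set cubic : MvPolynomial (Fin 4) F :=
    C (q ^ 2) * X 3 - (C (q ^ 2) ^ 2 + C (q ^ 2) + 1) * X 2 +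
        (C (q ^ 2) ^ 2 + C (q ^ 2) + 1) * X 1 - C (q ^ 2) * X 0 with hcubic
  have z₁ : ∀ g, insertEval A B B B (g * dgShadow (C (q ^ 2)) (X 0) (X 1)) = 0 := by
    intro g
    rw [mul_comm, ← hren, ← insertEval_bimodEval_left, h0]
    induction g using MvPolynomial.induction_on' with
    | add p q hp hq => rw [map_add, hp, hq, add_zero]
    | monomial m c => simp [insertEval_monomial]
  have z₂ : ∀ g, insertEval A B B B (g * dgShadow (C (q ^ 2)) (X 1) (X 2)) = 0 := by
    intro g
    rw [mul_comm, ← hren, ← insertEval_bimodEval_middle, h0]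
    induction g using MvPolynomial.induction_on' with
    | add p q hp hq => rw [map_add, hp, hq, add_zero]
    | monomial m c => simp [insertEval_monomial]
  have z₃ : ∀ g, insertEval A B B B (g * dgShadow (C (q ^ 2)) (X 2) (X 3)) = 0 := by
    intro g
    rw [mul_comm, ← hren, ← insertEval_bimodEval_right, h0]
    induction g using MvPolynomial.induction_on' with
    | add p q hp hq => rw [map_add, hp, hq, add_zero]
    | monomial m c => simp [insertEval_monomial]
  -- The second relation trades the form cubic in `B` for a commutator linear in `B`; this brings
  -- the four-variable terms back to two variables.
  have hcub : insertEval A B B B cubic = (q ^ 2 * c) •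
      bimodEval A B (X 0 - X 1 : MvPolynomial (Fin 2) F) := by
    rw [hcubic, insertEval_cubic hq hroot, h₂, zero_add, bimodEval_X_sub_X, smul_smul]
  have hcub' : insertEval A (bkImage q A B) (bkImage q A B) (bkImage q A B) cubic =
      q ^ 2 • (dolanGrady q (bkImage q A B) A +
        c • (A * bkImage q A B - bkImage q A B * A)) := by
    rw [hcubic, insertEval_cubic hq hroot]
  have htriple (cubic : MvPolynomial (Fin 4) F) : insertEval A B B B (bkShadow (C (q ^ 2)) (X 0) (X 1) *
      (bkShadow (C (q ^ 2)) (X 1) (X 2) * (bkShadow (C (q ^ 2)) (X 2) (X 3) * cubic))) =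
      k ^ 3 • insertEval A (bkImage q A B) (bkImage q A B) (bkImage q A B) cubic := by
    rw [← hrenb 0 1, ← hrenb 1 2, ← hrenb 2 3, ← insertEval_bimodEval_left,
      ← insertEval_bimodEval_middle, ← insertEval_bimodEval_right, bimodEval_bkShadow hq hroot]
    simp only [← hk_def]
    induction cubic using MvPolynomial.induction_on' with
    | add p q hp hq => rw [map_add, hp, hq, map_add, smul_add]
    | monomial m c =>
      simp only [insertEval_monomial, mul_smul_comm, smul_mul_assoc, smul_smul]
      congr 1; ring
  have hone : insertEval A B B B (bkShadow (C (q ^ 2)) (X 0) (X 3) * cubic) =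
      (q ^ 2 * c * k) • (A * bkImage q A B - bkImage q A B * A) := by
    rw [← hrenb, ← bimodEval_insertEval, hcub]
    rw [bimodEval_smul, bimodEval_mul, mul_comm (bkShadow _ _ _), ← bimodEval_mul,
      bimodEval_bkShadow hq hroot, ← hk_def, bimodEval_X_sub_X, mul_smul_comm,
      smul_mul_assoc, ← smul_sub, smul_smul]
  -- The factor in variables 0 and 3 acts from outside on that commutator, where the first relation
  -- kills it.
  have htail : ∀ g : MvPolynomial (Fin 2) F, insertEval A B B B (rename ![0, 3] g *
      dgShadow (C (q ^ 2)) (X 0) (X 3) * cubic) = 0 := by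
    intro g
    rw [← hren, ← map_mul, ← bimodEval_insertEval, hcub, bimodEval_smul, bimodEval_mul,
      mul_assoc, mul_comm _ (X 0 - X 1), ← mul_assoc, bimodEval_eq_zero h0, smul_zero]
  -- The certificate at `z = q²`. After evaluation only the first two products survive, and they
  -- compare the cubic in `bkImage q A B` with its commutator with `A`. Cancelling `k' * k ^ 3 * q ^
  -- 2` needs `q` not to be a root of unity.
  have key : C k' * (bkShadow (C (q ^ 2)) (X 0) (X 1) * (bkShadow (C (q ^ 2)) (X 1) (X 2) *
      (bkShadow (C (q ^ 2)) (X 2) (X 3) * cubic))) =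
      C (k ^ 2 * k') * (bkShadow (C (q ^ 2)) (X 0) (X 3) * cubic) +
      rename ![0, 3] (C (k ^ 2 * (q ^ 2) ^ 2) *
        (C ((q ^ 2) ^ 2) * X 0 - X 1 : MvPolynomial (Fin 2) F)) *
        dgShadow (C (q ^ 2)) (X 0) (X 3) * cubic +
      (C (q ^ 2) * (C (q ^ 2) - 1) ^ 2 * (C (q ^ 2) + 1) *
          bkCofactor₁ (C (q ^ 2)) (X 0) (X 1) (X 2) (X 3) * dgShadow (C (q ^ 2)) (X 0) (X 1) +
        C (q ^ 2) * (C (q ^ 2) - 1) ^ 2 * (C (q ^ 2) + 1) *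
          bkCofactor₂ (C (q ^ 2)) (X 0) (X 1) (X 2) (X 3) * dgShadow (C (q ^ 2)) (X 1) (X 2) +
        C (q ^ 2) * (C (q ^ 2) - 1) ^ 2 * (C (q ^ 2) + 1) *
          bkCofactor₃ (C (q ^ 2)) (X 0) (X 1) (X 2) (X 3) *
            dgShadow (C (q ^ 2)) (X 2) (X 3)) := by
    have h := bkShadow_mul_bkShadow_mul_bkShadow (C (q ^ 2) : MvPolynomial (Fin 4) F)
      (X 0) (X 1) (X 2) (X 3)
    rw [← hcubic] at h
    have ek : (C k : MvPolynomial (Fin 4) F) = (C (q ^ 2) - 1) * (C (q ^ 2) ^ 2 - 1) := by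
      simp [hk_def]
    have ek' : (C k' : MvPolynomial (Fin 4) F) =
        (C (q ^ 2) ^ 3 - 1) * (C (q ^ 2) ^ 4 - 1) := by
      simp [hk'_def]
    have hr : rename ![0, 3] (C (k ^ 2 * (q ^ 2) ^ 2) *
        (C ((q ^ 2) ^ 2) * X 0 - X 1 : MvPolynomial (Fin 2) F)) =
        C k ^ 2 * C (q ^ 2) ^ 2 * (C (q ^ 2) ^ 2 * X 0 - X 3 : MvPolynomial (Fin 4) F) := by
      simp
    have ekk : (C (k ^ 2 * k') : MvPolynomial (Fin 4) F) = C k ^ 2 * C k' := by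
      rw [map_mul, map_pow]
    rw [hr, ekk, ek, ek']
    linear_combination h
  have key' := congrArg (insertEval A B B B) key
  rw [map_add, map_add, htail, map_add, map_add, z₁, z₂, z₃, ← smul_eq_C_mul, map_smul, htriple,
    hcub', ← smul_eq_C_mul, map_smul, hone] at key'
  have hne : k' * k ^ 3 * q ^ 2 ≠ 0 :=
    mul_ne_zero (mul_ne_zero hk' (pow_ne_zero _ hk)) (pow_ne_zero _ hq)
  have hD : ∀ D E : R, (k' * k ^ 3 * q ^ 2) • D =
      k' • k ^ 3 • q ^ 2 • (D + c • E) - (k ^ 2 * k') • (q ^ 2 * c * k) • E := by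
    intro D E
    module
  refine (smul_eq_zero.mp ?_).resolve_left hne
  rw [hD _ (A * bkImage q A B - bkImage q A B * A), key']
  simp

/-- The two orientations are inverse up to a constant modulo `dgShadow`; this makes `bkImage` at
`q⁻¹` invert `bkImage` at `q`. -/
theorem bkShadow_swap_mul_bkShadow {S : Type*} [CommRing S] (z a b : S) :
    bkShadow z b a * bkShadow z a b =
      ((z - 1) * (z ^ 2 - 1)) ^ 2 + (a - b) * z * dgShadow z a b := by
  unfold bkShadow dgShadow
  ring

/-- `bkImage` for `q⁻¹` undoes `bkImage` for `q`. -/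
theorem bkImage_inv_bkImage (hq : q ≠ 0) (hroot : ∀ n : ℕ, 0 < n → q ^ n ≠ 1) {A B : R}
    (h : dolanGrady q A B = 0) : bkImage q⁻¹ A (bkImage q A B) = B := by
  set k := (q ^ 2 - 1) * ((q ^ 2) ^ 2 - 1) with hk_def
  have hk : k ≠ 0 := mul_ne_zero (by simpa using sq_sub_one_ne_zero hroot one_pos)
      (sq_sub_one_ne_zero hroot two_pos)
  have h0 : bimodEval A B (dgShadow (C (q ^ 2)) (X 0) (X 1)) = 0 := by
    rw [bimodEval_dgShadow hq hroot, h, smul_zero]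
  have key := congrArg (bimodEval A B)
    (bkShadow_swap_mul_bkShadow (C (q ^ 2) : MvPolynomial (Fin 2) F) (X 0) (X 1))
  have hC : (((C (q ^ 2) - 1) * (C (q ^ 2) ^ 2 - 1)) ^ 2 : MvPolynomial (Fin 2) F) =
      C (k ^ 2) * X 0 ^ 0 * X 1 ^ 0 := by
    simp [hk_def]
  rw [map_add, bimodEval_eq_zero h0, ← bimodEval_mul, bimodEval_bkShadow hq hroot, bimodEval_smul,
    bimodEval_bkShadow_swap hq hroot, hC, bimodEval_C_mul_X_pow_mul_X_pow, ← hk_def, smul_smul,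
    ← sq, pow_zero, one_mul, mul_one, add_zero] at key
  exact smul_right_injective R (pow_ne_zero 2 hk) key

end BraidRelations

end QOnsager

namespace QOnsager

/-! ### The q-Onsager algebra and its Baseilhac–Kolb automorphisms -/

section OnsagerAlgebra

variable {F : Type*} [Field F] {q : F} {R : Type*} [Ring R] [Algebra F R]

theorem map_dolanGrady {S : Type*} [Ring S] [Algebra F S] (f : R →ₐ[F] S) (X Y : R) :
    f (dolanGrady q X Y) = dolanGrady q (f X) (f Y) := by
  simp [dolanGrady]

theorem map_bkImage {S : Type*} [Ring S] [Algebra F S] (f : R →ₐ[F] S) (X Y : R) :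
    f (bkImage q X Y) = bkImage q (f X) (f Y) := by
  simp [bkImage]

/-- Lets the results for `q` be reused at `q⁻¹`, which supplies the inverse automorphism on the same
algebra. -/
theorem dolanGrady_inv (X Y : R) : dolanGrady q⁻¹ X Y = dolanGrady q X Y := by
  have e : qInt q⁻¹ 3 = qInt q 3 := by
    rw [qInt, qInt, ← neg_div_neg_eq, inv_inv]
    simp
  rw [dolanGrady, dolanGrady, e, inv_inv]
  congr 2
  ring

namespace Onsager

theorem dolanGrady_A_B : dolanGrady q (A q) (B q) = 0 := by
  have h : mk q _ = mk q _ := RingQuot.mkAlgHom_rel F (OnsagerRel.dg₁ (q := q))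
  rwa [map_dolanGrady, map_zero] at h

theorem dolanGrady_B_A : dolanGrady q (B q) (A q) = 0 := by
  have h : mk q _ = mk q _ := RingQuot.mkAlgHom_rel F (OnsagerRel.dg₂ (q := q))
  rwa [map_dolanGrady, map_zero] at h

/-- The universal property of the `q`-Onsager algebra. -/
noncomputable def lift {x y : R} (h₁ : dolanGrady q x y = 0) (h₂ : dolanGrady q y x = 0) :
    Onsager q →ₐ[F] R :=
  RingQuot.liftAlgHom F ⟨FreeAlgebra.lift F ![x, y], fun _ _ h => by
    cases h with
    | dg₁ => simpa [map_dolanGrady] using h₁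
    | dg₂ => simpa [map_dolanGrady] using h₂⟩

theorem lift_A {x y : R} (h₁ : dolanGrady q x y = 0) (h₂ : dolanGrady q y x = 0) :
    lift h₁ h₂ (A q) = x := by
  have h : lift h₁ h₂ (A q) = FreeAlgebra.lift F ![x, y] (FreeAlgebra.ι F 0) :=
    RingQuot.liftAlgHom_mkAlgHom_apply F _ _ _
  simpa using h

theorem lift_B {x y : R} (h₁ : dolanGrady q x y = 0) (h₂ : dolanGrady q y x = 0) :
    lift h₁ h₂ (B q) = y := by
  have h : lift h₁ h₂ (B q) = FreeAlgebra.lift F ![x, y] (FreeAlgebra.ι F 1) :=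
    RingQuot.liftAlgHom_mkAlgHom_apply F _ _ _
  simpa using h

theorem algHom_ext {f g : Onsager q →ₐ[F] R} (hA : f (A q) = g (A q)) (hB : f (B q) = g (B q)) :
    f = g := by
  refine RingQuot.ringQuot_ext' F _ _ (FreeAlgebra.hom_ext (funext fun i => ?_))
  fin_cases i
  · exact hA
  · exact hB

theorem algEquiv_ext {f g : Onsager q ≃ₐ[F] Onsager q} (hA : f (A q) = g (A q))
    (hB : f (B q) = g (B q)) : f = g := by
  have h : (f : Onsager q →ₐ[F] Onsager q) = g := algHom_ext hA hB
  ext x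
  exact DFunLike.congr_fun h x

/-- The automorphism fixing `A` and sending `B` to `bkImage q A B`. -/
theorem exists_algEquiv_A (hq : q ≠ 0) (hroot : ∀ n : ℕ, 0 < n → q ^ n ≠ 1) :
    ∃ T : Onsager q ≃ₐ[F] Onsager q, T (A q) = A q ∧ T (B q) = bkImage q (A q) (B q) := by
  have hq' : q⁻¹ ≠ 0 := inv_ne_zero hq
  have hroot' : ∀ n : ℕ, 0 < n → q⁻¹ ^ n ≠ 1 := by
    intro n hn
    simpa using hroot n hn
  have h₁ := dolanGrady_bkImage_right hq hroot (dolanGrady_A_B (q := q))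
  have h₂ := dolanGrady_bkImage_left hq hroot (dolanGrady_A_B (q := q)) dolanGrady_B_A
  have a := (dolanGrady_inv (q := q) (A q) (B q)).trans dolanGrady_A_B
  have b := (dolanGrady_inv (q := q) (B q) (A q)).trans dolanGrady_B_A
  have h₁' := (dolanGrady_inv _ _).symm.trans (dolanGrady_bkImage_right hq' hroot' a)
  have h₂' := (dolanGrady_inv _ _).symm.trans (dolanGrady_bkImage_left hq' hroot' a b)
  refine ⟨AlgEquiv.ofAlgHom (lift h₁ h₂) (lift h₁' h₂') (algHom_ext ?_ ?_) (algHom_ext ?_ ?_),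
    lift_A h₁ h₂, lift_B h₁ h₂⟩
  · simp [lift_A]
  · simp [lift_A, lift_B, map_bkImage, bkImage_inv_bkImage hq hroot dolanGrady_A_B]
  · simp [lift_A]
  · have e := bkImage_inv_bkImage hq' hroot' a
    rw [inv_inv] at e
    simp [lift_A, lift_B, map_bkImage, e]

/-- The automorphism exchanging `A` and `B`. -/
theorem exists_algEquiv_swap :
    ∃ S : Onsager q ≃ₐ[F] Onsager q, S (A q) = B q ∧ S (B q) = A q := by
  refine ⟨AlgEquiv.ofAlgHom (lift dolanGrady_B_A dolanGrady_A_B)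
    (lift dolanGrady_B_A dolanGrady_A_B) (algHom_ext ?_ ?_) (algHom_ext ?_ ?_),
    lift_A _ _, lift_B _ _⟩ <;> simp [lift_A, lift_B]

end Onsager

theorem existsUnique_isBaseilhacKolb (hq : q ≠ 0) (hroot : ∀ n : ℕ, 0 < n → q ^ n ≠ 1) :
    ∃! T : (Onsager q ≃ₐ[F] Onsager q) × (Onsager q ≃ₐ[F] Onsager q),
      IsBaseilhacKolb q T.1 T.2 := by
  obtain ⟨T, hA, hB⟩ := Onsager.exists_algEquiv_A hq hroot
  obtain ⟨S, sA, sB⟩ := Onsager.exists_algEquiv_swap (q := q)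
  have e : S (bkImage q (Onsager.A q) (Onsager.B q)) = bkImage q (Onsager.B q) (Onsager.A q) := by
    have h := map_bkImage (q := q) (S : Onsager q →ₐ[F] Onsager q) (Onsager.A q) (Onsager.B q)
    simpa [sA, sB] using h
  -- `T₁` is the conjugate of `T₀` by the involution exchanging `A` and `B`.
  refine ⟨(T, S * T * S), ⟨hA, hB, ?_, ?_⟩, ?_⟩
  · simp [hA, sA, sB]
  · simp [hB, sA, e]
  · rintro ⟨T₀, T₁⟩ h
    refine Prod.ext (Onsager.algEquiv_ext ?_ ?_) (Onsager.algEquiv_ext ?_ ?_)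
    · simpa [hA] using h.T₀_A
    · simpa [hB] using h.T₀_B
    · simpa [sA, hB, e] using h.T₁_A
    · simpa [hA, sA, sB] using h.T₁_B

end OnsagerAlgebra

end QOnsager

namespace QOnsager

/-! ### The universal Askey–Wilson algebra and its symmetries -/

section AskeyWilsonAlgebra

variable {F : Type*} [Field F] {q : F} {R : Type*} [Ring R] [Algebra F R]

theorem map_awElement {S : Type*} [Ring S] [Algebra F S] (f : R →ₐ[F] S) (X Y Z : R) :
    f (awElement q X Y Z) = awElement q (f X) (f Y) (f Z) := by
  simp [awElement]

/-- The image of `Z` under the involution exchanging `X` and `Y`. -/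
noncomputable def awFlip (q : F) (X Y Z : R) : R := Z + (q - q⁻¹)⁻¹ • (X * Y - Y * X)

/-- Explains the flip: `Z` is the element `awElement q Z X Y` minus a q-commutator of `X, Y`, and
the flip exchanges `X` and `Y` in that q-commutator while keeping the element. -/
theorem awFlip_eq (hq : q ≠ 0) (hroot : ∀ n : ℕ, 0 < n → q ^ n ≠ 1) (X Y Z : R) :
    awFlip q X Y Z = awElement q Z X Y - (q ^ 2 - q⁻¹ ^ 2)⁻¹ • (q • (Y * X) - q⁻¹ • (X * Y)) := by
  have e : (q - q⁻¹)⁻¹ = (q ^ 2 - q⁻¹ ^ 2)⁻¹ * (q + q⁻¹) := by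
    rw [inv_eq_iff_eq_inv, mul_inv, inv_inv, ← div_eq_mul_inv,
      eq_div_iff (add_inv_ne_zero hq hroot)]
    ring
  rw [awFlip, awElement, e]
  module

theorem awElement_awFlip_last (hq : q ≠ 0) (hroot : ∀ n : ℕ, 0 < n → q ^ n ≠ 1) (X Y Z : R) :
    awElement q (awFlip q X Y Z) Y X = awElement q Z X Y := by
  rw [awElement, awFlip_eq hq hroot]
  abel

/-- Eliminating `Z` through `awElement q Z X Y` turns both sides into the same expression in `X, Y`,
once that element commutes with `X`. -/
theorem awElement_awFlip_left (hq : q ≠ 0) (hroot : ∀ n : ℕ, 0 < n → q ^ n ≠ 1) {X Y Z : R}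
    (h : awElement q Z X Y * X = X * awElement q Z X Y) :
    awElement q Y X (awFlip q X Y Z) = awElement q Y Z X := by
  have hZ : Z = awElement q Z X Y - (q ^ 2 - q⁻¹ ^ 2)⁻¹ • (q • (X * Y) - q⁻¹ • (Y * X)) := by
    rw [awElement]; abel
  rw [awFlip_eq hq hroot]
  generalize awElement q Z X Y = g at *
  subst hZ
  simp only [awElement, mul_sub, sub_mul, mul_smul_comm, smul_mul_assoc, h, mul_assoc]
  module

theorem awElement_awFlip_right (hq : q ≠ 0) (hroot : ∀ n : ℕ, 0 < n → q ^ n ≠ 1) {X Y Z : R}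
    (h : awElement q Z X Y * Y = Y * awElement q Z X Y) :
    awElement q X (awFlip q X Y Z) Y = awElement q X Y Z := by
  have hZ : Z = awElement q Z X Y - (q ^ 2 - q⁻¹ ^ 2)⁻¹ • (q • (X * Y) - q⁻¹ • (Y * X)) := by
    rw [awElement]; abel
  rw [awFlip_eq hq hroot]
  generalize awElement q Z X Y = g at *
  subst hZ
  simp only [awElement, mul_sub, sub_mul, mul_smul_comm, smul_mul_assoc, h, mul_assoc]
  module

namespace AskeyWilson

theorem mk_surjective : Function.Surjective (mk q) :=
  RingQuot.mkAlgHom_surjective F (AskeyWilsonRel q)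

theorem central_A (r : AskeyWilson q) :
    awElement q (A q) (B q) (C q) * r = r * awElement q (A q) (B q) (C q) := by
  obtain ⟨x, rfl⟩ := mk_surjective r
  have h : mk q _ = mk q _ := RingQuot.mkAlgHom_rel F (AskeyWilsonRel.central_A (q := q) x)
  rwa [map_mul, map_mul, map_awElement] at h

theorem central_B (r : AskeyWilson q) :
    awElement q (B q) (C q) (A q) * r = r * awElement q (B q) (C q) (A q) := by
  obtain ⟨x, rfl⟩ := mk_surjective r
  have h : mk q _ = mk q _ := RingQuot.mkAlgHom_rel F (AskeyWilsonRel.central_B (q := q) x)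
  rwa [map_mul, map_mul, map_awElement] at h

theorem central_C (r : AskeyWilson q) :
    awElement q (C q) (A q) (B q) * r = r * awElement q (C q) (A q) (B q) := by
  obtain ⟨x, rfl⟩ := mk_surjective r
  have h : mk q _ = mk q _ := RingQuot.mkAlgHom_rel F (AskeyWilsonRel.central_C (q := q) x)
  rwa [map_mul, map_mul, map_awElement] at h

/-- A sufficient condition for a triple to define a homomorphism out of `Δ_q`. -/
structure IsTriple (q : F) (x y z : R) : Prop where
  left (r : R) : awElement q x y z * r = r * awElement q x y z
  middle (r : R) : awElement q y z x * r = r * awElement q y z x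
  right (r : R) : awElement q z x y * r = r * awElement q z x y

/-- The homomorphism out of `Δ_q` defined by a triple. -/
noncomputable def lift {x y z : R} (h : IsTriple q x y z) : AskeyWilson q →ₐ[F] R :=
  RingQuot.liftAlgHom F ⟨FreeAlgebra.lift F ![x, y, z], fun _ _ hr => by
    cases hr with
    | central_A r => simpa [map_awElement] using h.left _
    | central_B r => simpa [map_awElement] using h.middle _
    | central_C r => simpa [map_awElement] using h.right _⟩

theorem lift_mk_ι {x y z : R} (h : IsTriple q x y z) (i : Fin 3) :
    lift h (mk q (FreeAlgebra.ι F i)) = ![x, y, z] i :=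
  (RingQuot.liftAlgHom_mkAlgHom_apply F _ _ _).trans (FreeAlgebra.lift_ι_apply _ _)

theorem lift_A {x y z : R} (h : IsTriple q x y z) : lift h (A q) = x := lift_mk_ι h 0

theorem lift_B {x y z : R} (h : IsTriple q x y z) : lift h (B q) = y := lift_mk_ι h 1

theorem lift_C {x y z : R} (h : IsTriple q x y z) : lift h (C q) = z := lift_mk_ι h 2

theorem algHom_ext {f g : AskeyWilson q →ₐ[F] R} (hA : f (A q) = g (A q)) (hB : f (B q) = g (B q))
    (hC : f (C q) = g (C q)) : f = g := by
  refine RingQuot.ringQuot_ext' F _ _ (FreeAlgebra.hom_ext (funext fun i => ?_))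
  fin_cases i
  · exact hA
  · exact hB
  · exact hC

theorem algEquiv_ext {f g : AskeyWilson q ≃ₐ[F] AskeyWilson q} (hA : f (A q) = g (A q))
    (hB : f (B q) = g (B q)) (hC : f (C q) = g (C q)) : f = g := by
  have h : (f : AskeyWilson q →ₐ[F] AskeyWilson q) = g := algHom_ext hA hB hC
  ext x
  exact DFunLike.congr_fun h x

theorem exists_rotation : ∃ r : AskeyWilson q ≃ₐ[F] AskeyWilson q,
    r (A q) = B q ∧ r (B q) = C q ∧ r (C q) = A q := by
  have h : IsTriple q (B q) (C q) (A q) := ⟨central_B, central_C, central_A⟩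
  have h' : IsTriple q (C q) (A q) (B q) := ⟨central_C, central_A, central_B⟩
  exact ⟨AlgEquiv.ofAlgHom (lift h) (lift h')
    (algHom_ext (by simp [lift_A, lift_C]) (by simp [lift_A, lift_B])
      (by simp [lift_B, lift_C]))
    (algHom_ext (by simp [lift_A, lift_B]) (by simp [lift_B, lift_C])
      (by simp [lift_A, lift_C])), lift_A h, lift_B h, lift_C h⟩

theorem exists_flip (hq : q ≠ 0) (hroot : ∀ n : ℕ, 0 < n → q ^ n ≠ 1) :
    ∃ s : AskeyWilson q ≃ₐ[F] AskeyWilson q,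
      s (A q) = B q ∧ s (B q) = A q ∧ s (C q) = awFlip q (A q) (B q) (C q) := by
  have h : IsTriple q (B q) (A q) (awFlip q (A q) (B q) (C q)) := by
    refine ⟨?_, ?_, ?_⟩
    · rw [awElement_awFlip_left hq hroot (central_C _)]
      exact central_B
    · rw [awElement_awFlip_right hq hroot (central_C _)]
      exact central_A
    · rw [awElement_awFlip_last hq hroot]
      exact central_C
  have hC : lift h (awFlip q (A q) (B q) (C q)) = C q := by
    change lift h (C q + (q - q⁻¹)⁻¹ • (A q * B q - B q * A q)) = C q
    rw [map_add, map_smul, map_sub, map_mul, map_mul, lift_A, lift_B, lift_C]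
    change C q + (q - q⁻¹)⁻¹ • (A q * B q - B q * A q) + _ = C q
    module
  exact ⟨AlgEquiv.ofAlgHom (lift h) (lift h)
    (algHom_ext (by simp [lift_A, lift_B]) (by simp [lift_A, lift_B]) (by simp [lift_C, hC]))
    (algHom_ext (by simp [lift_A, lift_B]) (by simp [lift_A, lift_B]) (by simp [lift_C, hC])),
    lift_A h, lift_B h, lift_C h⟩

/-- The central elements `α`, `β`, `γ` are pairwise distinct. -/
theorem central_distinct (hq : q ≠ 0) (hroot : ∀ n : ℕ, 0 < n → q ^ n ≠ 1) :
    α q ≠ β q ∧ β q ≠ γ q ∧ γ q ≠ α q := by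
  have hs := add_inv_ne_zero hq hroot
  -- In a commutative target centrality is automatic, so every point of `F³` is a character of
  -- `Δ_q`; coordinate vectors separate `α, β, γ`.
  have triple : ∀ x y z : F, IsTriple q x y z := fun x y z =>
    ⟨fun _ => mul_comm _ _, fun _ => mul_comm _ _, fun _ => mul_comm _ _⟩
  refine ⟨fun h => ?_, fun h => ?_, fun h => ?_⟩
  · simpa [α, β, map_awElement, lift_A, lift_B, lift_C, awElement, hs] using
      congrArg (lift (triple 1 0 0)) h
  · simpa [β, γ, map_awElement, lift_A, lift_B, lift_C, awElement, hs] using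
      congrArg (lift (triple 0 1 0)) h
  · simpa [γ, α, map_awElement, lift_A, lift_B, lift_C, awElement, hs] using
      congrArg (lift (triple 0 0 1)) h

end AskeyWilson

theorem IsModularAction.map_central (hq : q ≠ 0) (hroot : ∀ n : ℕ, 0 < n → q ^ n ≠ 1)
    {Φ : PSL(2, ℤ) →* (AskeyWilson q ≃ₐ[F] AskeyWilson q)} (h : IsModularAction q Φ) :
    Φ ρ (AskeyWilson.α q) = AskeyWilson.β q ∧ Φ ρ (AskeyWilson.β q) = AskeyWilson.γ q ∧
      Φ ρ (AskeyWilson.γ q) = AskeyWilson.α q ∧ Φ σ (AskeyWilson.α q) = AskeyWilson.β q ∧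
      Φ σ (AskeyWilson.β q) = AskeyWilson.α q ∧ Φ σ (AskeyWilson.γ q) = AskeyWilson.γ q := by
  have key : ∀ (f : AskeyWilson q ≃ₐ[F] AskeyWilson q) (x y z : AskeyWilson q),
      f ((q + q⁻¹) • awElement q x y z) = (q + q⁻¹) • awElement q (f x) (f y) (f z) := by
    intro f x y z
    rw [map_smul]
    exact congrArg _ (map_awElement (f : AskeyWilson q →ₐ[F] AskeyWilson q) x y z)
  have hC : Φ σ (AskeyWilson.C q) =
    awFlip q (AskeyWilson.A q) (AskeyWilson.B q) (AskeyWilson.C q) := h.σ_C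
  simp only [AskeyWilson.α, AskeyWilson.β, AskeyWilson.γ, key, h.ρ_A, h.ρ_B, h.ρ_C, h.σ_A, h.σ_B,
    hC, awElement_awFlip_left hq hroot (AskeyWilson.central_C _),
    awElement_awFlip_right hq hroot (AskeyWilson.central_C _),
    awElement_awFlip_last hq hroot, and_self]

end AskeyWilsonAlgebra

end QOnsager

namespace QOnsager

/-! ### `PSL₂(ℤ)` as a free product of cyclic groups of orders 3 and 2 -/

section ModularGroup

open Matrix Pointwise

/-- The quotient map from `SL₂(ℤ)` onto `PSL₂(ℤ)`. -/
abbrev toPSL : SL(2, ℤ) →* PSL(2, ℤ) := QuotientGroup.mk' (Subgroup.center SL(2, ℤ))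

theorem toPSL_eq_iff {g h : SL(2, ℤ)} : toPSL g = toPSL h ↔ g = h ∨ g = -h := by
  rw [QuotientGroup.mk'_apply, QuotientGroup.mk'_apply, QuotientGroup.eq,
    Matrix.SpecialLinearGroup.mem_center_iff]
  constructor
  · rintro ⟨r, hr, h1⟩
    have hr' : r = 1 ∨ r = -1 := by simpa using hr
    have hh : (h : Matrix (Fin 2) (Fin 2) ℤ) = g * scalar (Fin 2) r := by
      rw [h1, ← Matrix.SpecialLinearGroup.coe_mul, mul_inv_cancel_left]
    rcases hr' with rfl | rfl
    · left; ext i j; simp [hh]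
    · right; ext i j; simp [hh]
  · rintro (rfl | rfl)
    · exact ⟨1, by simp⟩
    · refine ⟨-1, by simp, ?_⟩
      ext i j
      fin_cases i <;> fin_cases j <;> simp

theorem closure_ρMat_σMat : Subgroup.closure {ρMat, σMat} = ⊤ := by
  rw [eq_top_iff, ← _root_.SpecialLinearGroup.SL2Z_generators, Subgroup.closure_le]
  have hρ : ρMat ∈ Subgroup.closure {ρMat, σMat} := Subgroup.subset_closure (by simp)
  have hσ : σMat ∈ Subgroup.closure {ρMat, σMat} := Subgroup.subset_closure (by simp)
  have hT : ModularGroup.T = σMat⁻¹ * ρMat := by decide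
  rintro _ (rfl | rfl)
  · exact hσ
  · rw [hT]
    exact mul_mem (inv_mem hσ) hρ

theorem closure_ρ_σ : Subgroup.closure {ρ, σ} = ⊤ := by
  have h := congrArg (Subgroup.map toPSL) closure_ρMat_σMat
  rw [MonoidHom.map_closure, Set.image_pair, ← MonoidHom.range_eq_map,
    MonoidHom.range_eq_top.mpr (QuotientGroup.mk'_surjective _)] at h
  exact h

theorem σ_sq : σ ^ 2 = 1 := by
  change toPSL σMat ^ 2 = 1
  rw [← map_pow, ← map_one toPSL, toPSL_eq_iff]
  exact Or.inr (by decide)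

theorem ρ_cube : ρ ^ 3 = 1 := by
  change toPSL ρMat ^ 3 = 1
  rw [← map_pow, ← map_one toPSL, toPSL_eq_iff]
  exact Or.inr (by decide)

/-- The homomorphism from a finite cyclic group defined by an element of suitable order. -/
noncomputable def cyclicLift {G : Type*} [Group G] (n : ℕ) (g : G) (h : g ^ n = 1) :
    Multiplicative (ZMod n) →* G :=
  AddMonoidHom.toMultiplicativeLeft
    (ZMod.lift n ⟨(zmultiplesHom (Additive G)) (Additive.ofMul g), by
      simp [← ofMul_pow, h]⟩)

theorem cyclicLift_ofAdd_natCast {G : Type*} [Group G] (n : ℕ) (g : G) (h : g ^ n = 1) (k : ℕ) :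
    cyclicLift n g h (Multiplicative.ofAdd (k : ZMod n)) = g ^ k := by
  have e : ((k : ℤ) : ZMod n) = (k : ZMod n) := by simp
  rw [← e]
  simp [cyclicLift, -Int.cast_natCast]

end ModularGroup

end QOnsager

namespace QOnsager

section ModularGroup

open Matrix Pointwise

theorem SL2_mul_apply (g h : SL(2, ℤ)) (i j : Fin 2) :
    (g * h) i j = g i 0 * h 0 j + g i 1 * h 1 j := by
  simp [Matrix.mul_apply, Fin.sum_univ_two]

theorem PSL_smul_subset {x : SL(2, ℤ)} {P Q : SL(2, ℤ) → Prop} (h : ∀ g, P g → Q (x * g)) :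
    toPSL x • (toPSL '' {g | P g}) ⊆ toPSL '' {g | Q g} := by
  rintro _ ⟨_, ⟨g, hg, rfl⟩, rfl⟩
  exact ⟨x * g, h g hg, map_mul _ _ _⟩

theorem PSL_image_disjoint {P Q : SL(2, ℤ) → Prop} (hQ : ∀ g, Q g → Q (-g))
    (h : ∀ g, P g → ¬ Q g) : Disjoint (toPSL '' {g | P g}) (toPSL '' {g | Q g}) := by
  rw [Set.disjoint_left]
  rintro _ ⟨g, hg, rfl⟩ ⟨g', hg', e⟩
  rcases toPSL_eq_iff.mp e with rfl | rfl
  · exact h _ hg hg'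
  · exact h _ hg (by simpa using hQ _ hg')

/-- The orders of `ρ` and `σ`. -/
abbrev modularOrder : Fin 2 → ℕ := ![3, 2]

theorem modular_pow_order (i : Fin 2) : (![ρ, σ] i) ^ modularOrder i = 1 := by
  fin_cases i
  · exact ρ_cube
  · exact σ_sq

/-- The canonical map from the free product of cyclic groups of orders `3` and `2`. -/
noncomputable def coprodToPSL :
    Monoid.CoprodI (fun i : Fin 2 => Multiplicative (ZMod (modularOrder i))) →* PSL(2, ℤ) :=
  Monoid.CoprodI.lift fun i => cyclicLift (modularOrder i) (![ρ, σ] i) (modular_pow_order i)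

instance (i : Fin 2) : NeZero (modularOrder i) := ⟨by fin_cases i <;> decide⟩

/-- Ping-pong for left multiplication, played on the sign of the product `ac` for the first column
`(a, c)`. The matrix of `σ` turns `ac` into `-ac`, while those of `ρ` and `ρ²` give `-c(a + c)` and
`-a(a + c)`, both negative when `ac > 0`. -/
theorem coprodToPSL_injective : Function.Injective coprodToPSL := by
  have hdisj : Disjoint (toPSL '' {g | g 0 0 * g 1 0 < 0}) (toPSL '' {g | 0 < g 0 0 * g 1 0}) :=
    PSL_image_disjoint (fun g hg => by simpa using hg) fun g hg => not_lt.mpr hg.le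
  -- With two factors the criterion asks that one have at least three elements; index 0 is the
  -- factor of order 3.
  refine Monoid.CoprodI.lift_injective_of_ping_pong _ (Or.inr ⟨0, ?_⟩)
    ![toPSL '' {g | g 0 0 * g 1 0 < 0}, toPSL '' {g | 0 < g 0 0 * g 1 0}] ?_ ?_ ?_
  · change 3 ≤ Cardinal.mk (ZMod 3)
    rw [Cardinal.mk_fintype, ZMod.card]
    norm_num
  · intro i
    fin_cases i
    · have w : (⟨!![1, 0; -1, 1], by simp [Matrix.det_fin_two]⟩ : SL(2, ℤ)) ∈
          {g : SL(2, ℤ) | g 0 0 * g 1 0 < 0} := show (1 : ℤ) * -1 < 0 by simp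
      exact ⟨_, _, w, rfl⟩
    · have w : (⟨!![1, 0; 1, 1], by simp [Matrix.det_fin_two]⟩ : SL(2, ℤ)) ∈
          {g : SL(2, ℤ) | 0 < g 0 0 * g 1 0} := show (0 : ℤ) < 1 * 1 by simp
      exact ⟨_, _, w, rfl⟩
  · intro i j hij
    fin_cases i <;> fin_cases j
    · exact absurd rfl hij
    · exact hdisj
    · exact hdisj.symm
    · exact absurd rfl hij
  · have key : ∀ i j : Fin 2, i ≠ j → ∀ k < modularOrder i, k ≠ 0 → (![ρ, σ] i) ^ k •
        ![toPSL '' {g | g 0 0 * g 1 0 < 0}, toPSL '' {g | 0 < g 0 0 * g 1 0}] j ⊆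
        ![toPSL '' {g | g 0 0 * g 1 0 < 0}, toPSL '' {g | 0 < g 0 0 * g 1 0}] i := by
      intro i j hij k hk hk0
      fin_cases i <;> fin_cases j
      · exact absurd rfl hij
      · change k < 3 at hk
        change (toPSL ρMat) ^ k • (toPSL '' {g | 0 < g 0 0 * g 1 0}) ⊆
          toPSL '' {g | g 0 0 * g 1 0 < 0}
        rw [← map_pow]
        refine PSL_smul_subset fun g hg => ?_
        interval_cases k
        · exact absurd rfl hk0
        · rw [pow_one, SL2_mul_apply, SL2_mul_apply]
          simp [ρMat]
          nlinarith [sq_nonneg (g 1 0)]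
        · simp only [sq, mul_assoc, SL2_mul_apply]
          simp [ρMat]
          nlinarith [sq_nonneg (g 0 0)]
      · change k < 2 at hk
        change (toPSL σMat) ^ k • (toPSL '' {g | g 0 0 * g 1 0 < 0}) ⊆
          toPSL '' {g | 0 < g 0 0 * g 1 0}
        obtain rfl : k = 1 := by omega
        rw [pow_one]
        refine PSL_smul_subset fun g hg => ?_
        rw [SL2_mul_apply, SL2_mul_apply]
        simp [σMat]
        linarith
      · exact absurd rfl hij
    intro i j hij h hh
    have e : h = Multiplicative.ofAdd ((h.toAdd.val : ℕ) : ZMod (modularOrder i)) := by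
      rw [ZMod.natCast_zmod_val, ofAdd_toAdd]
    rw [e, cyclicLift_ofAdd_natCast]
    refine key i j hij _ (ZMod.val_lt _) fun h0 => hh ?_
    rw [e, h0]
    simp

theorem coprodToPSL_of_one (i : Fin 2) :
    coprodToPSL (Monoid.CoprodI.of (i := i) (Multiplicative.ofAdd 1)) = ![ρ, σ] i := by
  rw [coprodToPSL, Monoid.CoprodI.lift_of, ← Nat.cast_one, cyclicLift_ofAdd_natCast, pow_one]

theorem coprodToPSL_surjective : Function.Surjective coprodToPSL := by
  rw [← MonoidHom.range_eq_top, eq_top_iff, ← closure_ρ_σ, Subgroup.closure_le]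
  rintro _ (rfl | rfl)
  · exact ⟨_, coprodToPSL_of_one 0⟩
  · exact ⟨_, coprodToPSL_of_one 1⟩

/-- `PSL₂(ℤ)` is presented by the generators `ρ`, `σ` and the relations `ρ³ = σ² = 1`. -/
theorem exists_hom_of_PSL {G : Type*} [Group G] {r s : G} (hr : r ^ 3 = 1) (hs : s ^ 2 = 1) :
    ∃ Φ : PSL(2, ℤ) →* G, Φ ρ = r ∧ Φ σ = s := by
  have h : ∀ i, (![r, s] i) ^ modularOrder i = 1 := by
    intro i
    fin_cases i
    · exact hr
    · exact hs
  let e := MulEquiv.ofBijective coprodToPSL ⟨coprodToPSL_injective, coprodToPSL_surjective⟩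
  let Ψ := Monoid.CoprodI.lift (M := fun i : Fin 2 => Multiplicative (ZMod (modularOrder i)))
    fun i => cyclicLift (modularOrder i) (![r, s] i) (h i)
  have key : ∀ i, Ψ (e.symm (![ρ, σ] i)) = ![r, s] i := by
    intro i
    have e1 : e.symm (![ρ, σ] i) = Monoid.CoprodI.of (i := i) (Multiplicative.ofAdd 1) := by
      rw [MulEquiv.symm_apply_eq]
      exact (coprodToPSL_of_one i).symm
    rw [e1, Monoid.CoprodI.lift_of, ← Nat.cast_one, cyclicLift_ofAdd_natCast, pow_one]
  exact ⟨Ψ.comp e.symm.toMonoidHom, key 0, key 1⟩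

theorem PSL_hom_ext {G : Type*} [Group G] {f g : PSL(2, ℤ) →* G} (hρ : f ρ = g ρ)
    (hσ : f σ = g σ) : f = g := by
  refine MonoidHom.eq_of_eqOn_dense closure_ρ_σ ?_
  rintro _ (rfl | rfl)
  · exact hρ
  · exact hσ

end ModularGroup

theorem existsUnique_isModularAction {F : Type*} [Field F] {q : F} (hq : q ≠ 0)
    (hroot : ∀ n : ℕ, 0 < n → q ^ n ≠ 1) :
    ∃! Φ : PSL(2, ℤ) →* (AskeyWilson q ≃ₐ[F] AskeyWilson q), IsModularAction q Φ := by
  obtain ⟨r, rA, rB, rC⟩ := AskeyWilson.exists_rotation (q := q)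
  obtain ⟨s, sA, sB, sC⟩ := AskeyWilson.exists_flip hq hroot
  have hr : r ^ 3 = 1 := AskeyWilson.algEquiv_ext
    (by simp [pow_succ, rA, rB, rC]) (by simp [pow_succ, rA, rB, rC]) (by simp [pow_succ, rA, rB, rC])
  have hs : s ^ 2 = 1 := by
    refine AskeyWilson.algEquiv_ext (by simp [sq, sA, sB]) (by simp [sq, sA, sB]) ?_
    rw [sq, AlgEquiv.mul_apply, sC, awFlip, map_add, map_smul, map_sub, map_mul, map_mul, sA, sB,
      sC, awFlip, AlgEquiv.one_apply]
    module
  obtain ⟨Φ, hρ, hσ⟩ := exists_hom_of_PSL hr hs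
  refine ⟨Φ, ⟨by rw [hρ, rA], by rw [hρ, rB], by rw [hρ, rC], by rw [hσ, sA], by rw [hσ, sB],
    by rw [hσ, sC]; rfl⟩, fun Ψ h => PSL_hom_ext ?_ ?_⟩
  · rw [hρ]
    exact AskeyWilson.algEquiv_ext (h.ρ_A.trans rA.symm) (h.ρ_B.trans rB.symm)
      (h.ρ_C.trans rC.symm)
  · rw [hσ]
    exact AskeyWilson.algEquiv_ext (h.σ_A.trans sA.symm) (h.σ_B.trans sB.symm)
      (h.σ_C.trans sC.symm)

end QOnsager

namespace QOnsager

/-! ### Free groups and ping-pong -/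

section GroupTheory

/-- A free group is a free product of infinite cyclic groups, so ping-pong for free products applies
with one set per generator. -/
theorem freeGroup_lift_injective_of_ping_pong {ι G α : Type*} [Nontrivial ι] [Group G]
    [MulAction G α] (a : ι → G) (X : ι → Set α) (hne : ∀ i, (X i).Nonempty)
    (hdisj : Pairwise (Function.onFun Disjoint X))
    (h : ∀ i j, i ≠ j → ∀ n : ℤ, n ≠ 0 → ∀ x ∈ X j, a i ^ n • x ∈ X i) :
    Function.Injective (FreeGroup.lift a) := by
  let e : FreeGroup ι →* Monoid.CoprodI (fun _ : ι => Multiplicative ℤ) :=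
    FreeGroup.lift fun i => Monoid.CoprodI.of (i := i) (Multiplicative.ofAdd 1)
  let e' : Monoid.CoprodI (fun _ : ι => Multiplicative ℤ) →* FreeGroup ι :=
    Monoid.CoprodI.lift fun i => zpowersHom _ (FreeGroup.of i)
  have he : Function.Injective e := by
    have h1 : e'.comp e = MonoidHom.id _ := by
      ext i
      simp [e, e']
    exact Function.LeftInverse.injective (g := e') (DFunLike.congr_fun h1)
  have hlift : FreeGroup.lift a = (Monoid.CoprodI.lift fun i => zpowersHom _ (a i)).comp e := by
    ext i
    simp [e]
  rw [hlift, MonoidHom.coe_comp]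
  refine Function.Injective.comp ?_ he
  obtain ⟨i⟩ : Nonempty ι := inferInstance
  refine Monoid.CoprodI.lift_injective_of_ping_pong _ (Or.inr ⟨i, ?_⟩) X hne hdisj ?_
  · exact (Cardinal.natCast_le_aleph0 (n := 3)).trans (Cardinal.aleph0_le_mk (Multiplicative ℤ))
  · rintro i j hij n hn _ ⟨x, hx, rfl⟩
    exact h i j hij n.toAdd (fun h0 => hn h0) x hx

theorem exists_freeGroupBasis {ι G : Type*} [Group G] {a : ι → G}
    (ha : Function.Injective (FreeGroup.lift a)) {H : Subgroup G}
    (hH : Subgroup.closure (Set.range a) = H) :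
    ∃ b : FreeGroupBasis ι H, ∀ i, (b i : G) = a i := by
  have hr : (FreeGroup.lift a).range = H := by
    rw [← hH, FreeGroup.range_lift_eq_closure]
  subst hr
  refine ⟨⟨(MonoidHom.ofInjective ha).symm⟩, fun i => ?_⟩
  exact FreeGroup.lift_apply_of

end GroupTheory

/-! ### The image of `Γ(2)` is free on `t₀, t₁` -/

section PrincipalCongruence

open Matrix

/-- The upper unitriangular matrices in `SL₂(ℤ)`. -/
def upperUni : Multiplicative ℤ →* SL(2, ℤ) where
  toFun n := ⟨!![1, n.toAdd; 0, 1], by simp [Matrix.det_fin_two]⟩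
  map_one' := by ext i j; fin_cases i <;> fin_cases j <;> simp
  map_mul' m n := Subtype.ext (by
    change !![1, m.toAdd + n.toAdd; 0, 1] = !![1, m.toAdd; 0, 1] * !![1, n.toAdd; 0, 1]
    simp [add_comm])

/-- The lower unitriangular matrices in `SL₂(ℤ)`. -/
def lowerUni : Multiplicative ℤ →* SL(2, ℤ) where
  toFun n := ⟨!![1, 0; n.toAdd, 1], by simp [Matrix.det_fin_two]⟩
  map_one' := by ext i j; fin_cases i <;> fin_cases j <;> simp
  map_mul' m n := Subtype.ext (by
    change !![1, 0; m.toAdd + n.toAdd, 1] = !![1, 0; m.toAdd, 1] * !![1, 0; n.toAdd, 1]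
    simp)

/-- `U n = !![1, n; 0, 1]`. -/
abbrev U (n : ℤ) : SL(2, ℤ) := upperUni (Multiplicative.ofAdd n)

/-- `L n = !![1, 0; n, 1]`. -/
abbrev L (n : ℤ) : SL(2, ℤ) := lowerUni (Multiplicative.ofAdd n)

theorem U_apply (n : ℤ) : U n 0 0 = 1 ∧ U n 0 1 = n ∧ U n 1 0 = 0 ∧ U n 1 1 = 1 :=
  ⟨rfl, rfl, rfl, rfl⟩

theorem L_apply (n : ℤ) : L n 0 0 = 1 ∧ L n 0 1 = 0 ∧ L n 1 0 = n ∧ L n 1 1 = 1 :=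
  ⟨rfl, rfl, rfl, rfl⟩

theorem U_mul_zero (n : ℤ) (g : SL(2, ℤ)) (j : Fin 2) : (U n * g) 0 j = g 0 j + n * g 1 j := by
  obtain ⟨h₀, h₁, h₂, h₃⟩ := U_apply n
  rw [SL2_mul_apply, h₀, h₁]
  ring

theorem U_mul_one (n : ℤ) (g : SL(2, ℤ)) (j : Fin 2) : (U n * g) 1 j = g 1 j := by
  obtain ⟨h₀, h₁, h₂, h₃⟩ := U_apply n
  rw [SL2_mul_apply, h₂, h₃]
  ring

theorem L_mul_zero (n : ℤ) (g : SL(2, ℤ)) (j : Fin 2) : (L n * g) 0 j = g 0 j := by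
  obtain ⟨h₀, h₁, h₂, h₃⟩ := L_apply n
  rw [SL2_mul_apply, h₀, h₁]
  ring

theorem L_mul_one (n : ℤ) (g : SL(2, ℤ)) (j : Fin 2) : (L n * g) 1 j = n * g 0 j + g 1 j := by
  obtain ⟨h₀, h₁, h₂, h₃⟩ := L_apply n
  rw [SL2_mul_apply, h₂, h₃]
  ring

theorem U_zpow (m n : ℤ) : U m ^ n = U (n * m) := by
  rw [U, ← map_zpow, ← ofAdd_zsmul, smul_eq_mul]

theorem L_zpow (m n : ℤ) : L m ^ n = L (n * m) := by
  rw [L, ← map_zpow, ← ofAdd_zsmul, smul_eq_mul]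

theorem t₀_eq : t₀ = toPSL (U (-2)) := by
  have h : (ρMat ^ 2 * σMat) ^ 2 = U (-2) := by decide
  rw [← h]; rfl

theorem t₁_eq : t₁ = toPSL (L 2) := by
  have h : (σMat * ρMat ^ 2) ^ 2 = L 2 := by decide
  rw [← h]; rfl

/-- Ping-pong on the first column `(a, c)`: nonzero powers of `t₀` make `|a|` dominate, nonzero
powers of `t₁` make `|c|` dominate. -/
theorem lift_t₀_t₁_injective : Function.Injective (FreeGroup.lift ![t₀, t₁]) := by
  have hdisj : Disjoint (toPSL '' {g : SL(2, ℤ) | |g 1 0| < |g 0 0|})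
      (toPSL '' {g : SL(2, ℤ) | |g 0 0| < |g 1 0|}) :=
    PSL_image_disjoint (fun g hg => by simpa using hg) fun g hg => not_lt.mpr hg.le
  refine freeGroup_lift_injective_of_ping_pong (α := PSL(2, ℤ)) _
    ![toPSL '' {g | |g 1 0| < |g 0 0|}, toPSL '' {g | |g 0 0| < |g 1 0|}] ?_ ?_ ?_
  · intro i
    fin_cases i
    · have w : (1 : SL(2, ℤ)) ∈ {g : SL(2, ℤ) | |g 1 0| < |g 0 0|} :=
        show |(0 : ℤ)| < |1| by simp
      exact ⟨_, _, w, rfl⟩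
    · have w : σMat ∈ {g : SL(2, ℤ) | |g 0 0| < |g 1 0|} := show |(0 : ℤ)| < |1| by simp
      exact ⟨_, _, w, rfl⟩
  · intro i j hij
    fin_cases i <;> fin_cases j
    · exact absurd rfl hij
    · exact hdisj
    · exact hdisj.symm
    · exact absurd rfl hij
  · have est : ∀ a c n : ℤ, n ≠ 0 → |a| < |c| → |c| < |a + n * 2 * c| := by
      intro a c n hn h
      have h1 : 1 ≤ |n| := Int.one_le_abs hn
      have h2 : |n * 2 * c| ≤ |a + n * 2 * c| + |a| := by
        have := abs_sub (a + n * 2 * c) a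
        simpa using this
      rw [abs_mul, abs_mul, abs_two] at h2
      nlinarith [abs_nonneg c]
    intro i j hij n hn x hx
    fin_cases i <;> fin_cases j
    · exact absurd rfl hij
    · change x ∈ toPSL '' {g : SL(2, ℤ) | |g 0 0| < |g 1 0|} at hx
      change t₀ ^ n • x ∈ toPSL '' {g : SL(2, ℤ) | |g 1 0| < |g 0 0|}
      obtain ⟨g, hg, rfl⟩ := hx
      refine ⟨U (-2) ^ n * g, ?_, by rw [map_mul, map_zpow, t₀_eq]; rfl⟩
      have h := est (g 0 0) (g 1 0) (-n) (neg_ne_zero.mpr hn) hg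
      rw [U_zpow]
      change |(U (n * -2) * g) 1 0| < |(U (n * -2) * g) 0 0|
      rw [U_mul_zero, U_mul_one]
      convert h using 3
      ring
    · change x ∈ toPSL '' {g : SL(2, ℤ) | |g 1 0| < |g 0 0|} at hx
      change t₁ ^ n • x ∈ toPSL '' {g : SL(2, ℤ) | |g 0 0| < |g 1 0|}
      obtain ⟨g, hg, rfl⟩ := hx
      refine ⟨L 2 ^ n * g, ?_, by rw [map_mul, map_zpow, t₁_eq]; rfl⟩
      have h := est (g 1 0) (g 0 0) n hn hg
      rw [L_zpow]
      change |(L (n * 2) * g) 0 0| < |(L (n * 2) * g) 1 0|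
      rw [L_mul_zero, L_mul_one, add_comm]
      exact h
    · exact absurd rfl hij

theorem SL2_ext {g h : SL(2, ℤ)} (h₀ : g 0 0 = h 0 0) (h₁ : g 0 1 = h 0 1)
    (h₂ : g 1 0 = h 1 0) (h₃ : g 1 1 = h 1 1) : g = h := by
  ext i j
  fin_cases i <;> fin_cases j <;> assumption

theorem mem_Gamma_two_iff (g : SL(2, ℤ)) : g ∈ CongruenceSubgroup.Gamma 2 ↔
    g 0 0 % 2 = 1 ∧ g 0 1 % 2 = 0 ∧ g 1 0 % 2 = 0 ∧ g 1 1 % 2 = 1 := by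
  have h1 : ∀ a : ℤ, (a : ZMod 2) = 1 ↔ a % 2 = 1 := fun a => by
    have := ZMod.intCast_eq_intCast_iff' a 1 2
    simpa using this
  have h0 : ∀ a : ℤ, (a : ZMod 2) = 0 ↔ a % 2 = 0 := fun a => by
    have := ZMod.intCast_eq_intCast_iff' a 0 2
    simpa using this
  rw [CongruenceSubgroup.Gamma_mem, h1, h0, h0, h1]

theorem U_mem_Gamma_two (n : ℤ) : U (n * 2) ∈ CongruenceSubgroup.Gamma 2 := by
  obtain ⟨h₀, h₁, h₂, h₃⟩ := U_apply (n * 2)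
  rw [mem_Gamma_two_iff, h₀, h₁, h₂, h₃]
  simp

theorem L_mem_Gamma_two (n : ℤ) : L (n * 2) ∈ CongruenceSubgroup.Gamma 2 := by
  obtain ⟨h₀, h₁, h₂, h₃⟩ := L_apply (n * 2)
  rw [mem_Gamma_two_iff, h₀, h₁, h₂, h₃]
  simp

theorem toPSL_U_mem (n : ℤ) : toPSL (U (n * 2)) ∈ Subgroup.closure {t₀, t₁} := by
  have h : toPSL (U (n * 2)) = t₀ ^ (-n) := by
    rw [t₀_eq, ← map_zpow, U_zpow]
    ring_nf
  rw [h]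
  exact zpow_mem (Subgroup.subset_closure (by simp)) _

theorem toPSL_L_mem (n : ℤ) : toPSL (L (n * 2)) ∈ Subgroup.closure {t₀, t₁} := by
  have h : toPSL (L (n * 2)) = t₁ ^ n := by
    rw [t₁_eq, ← map_zpow, L_zpow]
  rw [h]
  exact zpow_mem (Subgroup.subset_closure (by simp)) _

/-- Euclidean algorithm on the first column `(a, c)`: adding `±2` times the entry of smaller
absolute value to the other strictly reduces the latter. As `a` is odd and `c` even, the absolute
values never coincide, and the process stops only at `c = 0`, where the matrix is `±U` of an even
integer. -/
theorem toPSL_mem_closure_of_mem_Gamma_two (g : SL(2, ℤ)) (hg : g ∈ CongruenceSubgroup.Gamma 2) :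
    toPSL g ∈ Subgroup.closure {t₀, t₁} := by
  induction hn : (g 0 0).natAbs + (g 1 0).natAbs using Nat.strong_induction_on generalizing g with
  | _ n ih =>
  obtain ⟨ha, hb, hc, hd⟩ := (mem_Gamma_two_iff g).mp hg
  have hdet : g 0 0 * g 1 1 - g 0 1 * g 1 0 = 1 := by
    rw [← Matrix.det_fin_two, g.det_coe]
  have stepU : ∀ k : ℤ, (g 0 0 + k * 2 * g 1 0).natAbs < (g 0 0).natAbs →
      toPSL g ∈ Subgroup.closure {t₀, t₁} := by
    intro k hk
    have h := ih _ (by rw [← hn, U_mul_zero, U_mul_one]; omega) (U (k * 2) * g)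
      (mul_mem (U_mem_Gamma_two k) hg) rfl
    rw [map_mul] at h
    exact (Subgroup.mul_mem_cancel_left _ (toPSL_U_mem k)).mp h
  have stepL : ∀ k : ℤ, (k * 2 * g 0 0 + g 1 0).natAbs < (g 1 0).natAbs →
      toPSL g ∈ Subgroup.closure {t₀, t₁} := by
    intro k hk
    have h := ih _ (by rw [← hn, L_mul_zero, L_mul_one]; omega) (L (k * 2) * g)
      (mul_mem (L_mem_Gamma_two k) hg) rfl
    rw [map_mul] at h
    exact (Subgroup.mul_mem_cancel_left _ (toPSL_L_mem k)).mp h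
  by_cases hc0 : g 1 0 = 0
  · rw [hc0, mul_zero, sub_zero] at hdet
    rcases Int.eq_one_or_neg_one_of_mul_eq_one' hdet with ⟨h0, h1⟩ | ⟨h0, h1⟩
    · have e : toPSL g = toPSL (U (g 0 1 / 2 * 2)) := by
        rw [toPSL_eq_iff]
        obtain ⟨u₀, u₁, u₂, u₃⟩ := U_apply (g 0 1 / 2 * 2)
        exact Or.inl (SL2_ext (by rw [h0, u₀]) (by rw [u₁]; omega) (by rw [hc0, u₂])
          (by rw [h1, u₃]))
      rw [e]
      exact toPSL_U_mem _
    · have e : toPSL g = toPSL (U (-(g 0 1 / 2) * 2)) := by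
        rw [toPSL_eq_iff]
        obtain ⟨u₀, u₁, u₂, u₃⟩ := U_apply (-(g 0 1 / 2) * 2)
        have hneg : ∀ (h : SL(2, ℤ)) (i j : Fin 2), (-h) i j = -(h i j) := fun _ _ _ => rfl
        exact Or.inr (SL2_ext (by rw [hneg, h0, u₀]) (by rw [hneg, u₁]; omega)
          (by rw [hneg, hc0, u₂, neg_zero]) (by rw [hneg, h1, u₃]))
      rw [e]
      exact toPSL_U_mem _
  · rcases lt_trichotomy (g 0 0).natAbs (g 1 0).natAbs with h | h | h
    · by_cases hs : 0 ≤ g 0 0 ↔ 0 ≤ g 1 0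
      · exact stepL (-1) (by omega)
      · exact stepL 1 (by omega)
    · omega
    · by_cases hs : 0 ≤ g 0 0 ↔ 0 ≤ g 1 0
      · exact stepU (-1) (by omega)
      · exact stepU 1 (by omega)

theorem closure_t₀_t₁ :
    Subgroup.closure (Set.range ![t₀, t₁]) = (CongruenceSubgroup.Gamma 2).map toPSL := by
  rw [Matrix.range_cons_cons_empty]
  apply le_antisymm
  · rw [Subgroup.closure_le]
    rintro _ (rfl | rfl)
    · rw [t₀_eq, show (-2 : ℤ) = -1 * 2 by norm_num]
      exact Subgroup.mem_map_of_mem _ (U_mem_Gamma_two (-1))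
    · rw [t₁_eq, show L 2 = L (1 * 2) by norm_num]
      exact Subgroup.mem_map_of_mem _ (L_mem_Gamma_two 1)
  · rintro _ ⟨g, hg, rfl⟩
    exact toPSL_mem_closure_of_mem_Gamma_two g hg

end PrincipalCongruence

end QOnsager

namespace QOnsager

/-! ### The kernel of the action on `α, β, γ` -/

section ModularKernel

variable {F : Type*} [Field F] {q : F}

open Matrix

/-- The elements `α`, `β`, `γ` indexed by the nonzero vectors of `(ℤ/2)²`. -/
noncomputable def centralAt (q : F) (v : Fin 2 → ZMod 2) : AskeyWilson q :=
  (![![0, AskeyWilson.β q], ![AskeyWilson.α q, AskeyWilson.γ q]] : Fin 2 → Fin 2 → AskeyWilson q)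
    (v 0) (v 1)

/-- Reduction of `SL₂(ℤ)` modulo `2`. -/
abbrev modTwo : SL(2, ℤ) →* SL(2, ZMod 2) := Matrix.SpecialLinearGroup.map (Int.castRingHom (ZMod 2))

/-- Under this indexing `ρ` and `σ` act as their matrices modulo 2, and equivariance propagates from
generators to the whole group. -/
theorem map_centralAt (hq : q ≠ 0) (hroot : ∀ n : ℕ, 0 < n → q ^ n ≠ 1)
    {Φ : PSL(2, ℤ) →* (AskeyWilson q ≃ₐ[F] AskeyWilson q)} (h : IsModularAction q Φ)
    (g : SL(2, ℤ)) (v : Fin 2 → ZMod 2) :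
    Φ (toPSL g) (centralAt q v) = centralAt q ((modTwo g : Matrix _ _ _) *ᵥ v) := by
  obtain ⟨r₁, r₂, r₃, s₁, s₂, s₃⟩ := h.map_central hq hroot
  have hg : g ∈ Subgroup.closure {ρMat, σMat} := by rw [closure_ρMat_σMat]; trivial
  induction hg using Subgroup.closure_induction generalizing v with
  | mem x hx =>
    have hv : v = ![v 0, v 1] := by ext i; fin_cases i <;> rfl
    rw [hv]
    generalize v 0 = a, v 1 = b
    rcases hx with rfl | rfl
    · have e : ((modTwo ρMat : SL(2, ZMod 2)) : Matrix _ _ _) *ᵥ ![a, b] = ![b, a + b] := by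
        revert a b; decide
      rw [e]
      change Φ ρ _ = _
      fin_cases a <;> fin_cases b
      · exact map_zero _
      · exact r₂
      · exact r₁
      · exact r₃
    · have e : ((modTwo σMat : SL(2, ZMod 2)) : Matrix _ _ _) *ᵥ ![a, b] = ![b, a] := by
        revert a b; decide
      rw [e]
      change Φ σ _ = _
      fin_cases a <;> fin_cases b
      · exact map_zero _
      · exact s₂
      · exact s₁
      · exact s₃
  | one => simp
  | mul x y _ _ hx hy =>
    rw [map_mul, map_mul, AlgEquiv.mul_apply, hy, hx, map_mul, Matrix.SpecialLinearGroup.coe_mul,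
      Matrix.mulVec_mulVec]
  | inv x _ hx =>
    rw [map_inv, map_inv]
    change (Φ (toPSL x)).symm _ = _
    rw [AlgEquiv.symm_apply_eq, hx,
      Matrix.mulVec_mulVec, ← Matrix.SpecialLinearGroup.coe_mul, ← map_mul, mul_inv_cancel,
      map_one, Matrix.SpecialLinearGroup.coe_one, Matrix.one_mulVec]

theorem modularKernel_eq (hq : q ≠ 0) (hroot : ∀ n : ℕ, 0 < n → q ^ n ≠ 1)
    {Φ : PSL(2, ℤ) →* (AskeyWilson q ≃ₐ[F] AskeyWilson q)} (h : IsModularAction q Φ) :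
    modularKernel Φ = (CongruenceSubgroup.Gamma 2).map toPSL := by
  obtain ⟨hαβ, hβγ, hγα⟩ := AskeyWilson.central_distinct hq hroot
  obtain ⟨r₁, r₂, r₃, -⟩ := h.map_central hq hroot
  -- `centralAt` takes the value 0 at the zero vector, so that vector must be separated from the
  -- others too.
  have hα : AskeyWilson.α q ≠ 0 := fun h0 => hαβ (by rw [← r₁, h0, map_zero])
  have hβ : AskeyWilson.β q ≠ 0 := fun h0 => hβγ (by rw [← r₂, h0, map_zero])
  have eα : centralAt q ![1, 0] = AskeyWilson.α q := rfl
  have eβ : centralAt q ![0, 1] = AskeyWilson.β q := rfl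
  have eγ : centralAt q ![1, 1] = AskeyWilson.γ q := rfl
  ext p
  obtain ⟨g, rfl⟩ := QuotientGroup.mk'_surjective _ p
  have hmem : toPSL g ∈ modularKernel Φ ↔ Φ (toPSL g) (AskeyWilson.α q) = AskeyWilson.α q ∧
      Φ (toPSL g) (AskeyWilson.β q) = AskeyWilson.β q ∧
      Φ (toPSL g) (AskeyWilson.γ q) = AskeyWilson.γ q := by
    simp [modularKernel, mem_fixingSubgroup_iff]
  rw [hmem, ← eα, ← eβ, ← eγ, map_centralAt hq hroot h, map_centralAt hq hroot h,
    map_centralAt hq hroot h]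
  constructor
  -- Fixing `α` and `β` already fixes both basis vectors of `(ℤ/2)²`, which determines the matrix
  -- modulo 2.
  · rintro ⟨h₁, h₂, -⟩
    have inj₁ : ∀ v : Fin 2 → ZMod 2, centralAt q v = centralAt q ![1, 0] → v = ![1, 0] := by
      intro v hv
      have hv' : v = ![v 0, v 1] := by ext i; fin_cases i <;> rfl
      rw [hv'] at hv ⊢
      generalize v 0 = a, v 1 = b at *
      fin_cases a <;> fin_cases b
      · exact absurd hv.symm hα
      · exact absurd hv.symm hαβ
      · rfl
      · exact absurd hv hγα
    have inj₂ : ∀ v : Fin 2 → ZMod 2, centralAt q v = centralAt q ![0, 1] → v = ![0, 1] := by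
      intro v hv
      have hv' : v = ![v 0, v 1] := by ext i; fin_cases i <;> rfl
      rw [hv'] at hv ⊢
      generalize v 0 = a, v 1 = b at *
      fin_cases a <;> fin_cases b
      · exact absurd hv.symm hβ
      · rfl
      · exact absurd hv hαβ
      · exact absurd hv.symm hβγ
    have c₁ := inj₁ _ h₁
    have c₂ := inj₂ _ h₂
    have hM : modTwo g = 1 := by
      generalize modTwo g = M at c₁ c₂
      ext i j
      fin_cases j
      · have := congrFun c₁ i
        simp only [Matrix.mulVec, dotProduct, Fin.sum_univ_two] at this
        fin_cases i <;> simpa using this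
      · have := congrFun c₂ i
        simp only [Matrix.mulVec, dotProduct, Fin.sum_univ_two] at this
        fin_cases i <;> simpa using this
    exact Subgroup.mem_map_of_mem _ (CongruenceSubgroup.Gamma_mem'.mpr hM)
  · rintro ⟨g', hg', e⟩
    have hg : g ∈ CongruenceSubgroup.Gamma 2 := by
      have hneg : ∀ (h : SL(2, ℤ)) (i j : Fin 2), (-h) i j = -(h i j) := fun _ _ _ => rfl
      rcases toPSL_eq_iff.mp e with rfl | rfl
      · exact hg'
      · rw [SetLike.mem_coe, mem_Gamma_two_iff] at hg'
        rw [mem_Gamma_two_iff]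
        simp only [hneg] at hg'
        omega
    have hM : modTwo g = 1 := CongruenceSubgroup.Gamma_mem'.mp hg
    simp only [hM, Matrix.SpecialLinearGroup.coe_one, Matrix.one_mulVec, and_self]

end ModularKernel

end QOnsager

namespace QOnsager

/-! ### The quantum torus -/

section QuantumTorus

open Matrix

variable {F : Type*} [Field F]

/-- The standard symplectic form on `ℤ²`. -/
def symp (w z : Fin 2 → ℤ) : ℤ := w 1 * z 0 - w 0 * z 1

/-- The generator `X_w` of the quantum torus, acting on the free module on `ℤ²`. -/
noncomputable def torusX (q : F) (w : Fin 2 → ℤ) : Module.End F ((Fin 2 → ℤ) →₀ F) :=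
  Finsupp.linearCombination F fun z => Finsupp.single (w + z) (q ^ symp w z)

theorem torusX_single (q : F) (w z : Fin 2 → ℤ) :
    torusX q w (Finsupp.single z 1) = Finsupp.single (w + z) (q ^ symp w z) := by
  simp [torusX]

theorem torusX_mul {q : F} (hq : q ≠ 0) (w w' : Fin 2 → ℤ) :
    torusX q w * torusX q w' = q ^ symp w w' • torusX q (w + w') := by
  ext z : 2
  have h : (Finsupp.single (w' + z) (q ^ symp w' z) : (Fin 2 → ℤ) →₀ F) =
      q ^ symp w' z • Finsupp.single (w' + z) 1 := by simp
  simp only [LinearMap.comp_apply, Module.End.mul_apply, Finsupp.lsingle_apply, torusX_single,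
    LinearMap.smul_apply]
  rw [h, map_smul, torusX_single, Finsupp.smul_single, Finsupp.smul_single, add_assoc, smul_eq_mul,
    smul_eq_mul, ← zpow_add₀ hq, ← zpow_add₀ hq]
  congr 2
  simp [symp]
  ring

/-- `X_w + X_{-w}`. -/
noncomputable def torusE (q : F) (w : Fin 2 → ℤ) : Module.End F ((Fin 2 → ℤ) →₀ F) :=
  torusX q w + torusX q (-w)

theorem torusE_neg (q : F) (w : Fin 2 → ℤ) : torusE q (-w) = torusE q w := by
  rw [torusE, torusE, neg_neg, add_comm]

theorem torusE_mul {q : F} (hq : q ≠ 0) (w w' : Fin 2 → ℤ) :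
    torusE q w * torusE q w' =
      q ^ symp w w' • torusE q (w + w') + q ^ (-symp w w') • torusE q (w' - w) := by
  have h₁ : symp (-w) w' = -symp w w' := by simp [symp]; ring
  have h₂ : symp w (-w') = -symp w w' := by simp [symp]; ring
  have h₃ : symp (-w) (-w') = symp w w' := by simp [symp]
  simp only [torusE, add_mul, mul_add, torusX_mul hq, h₁, h₂, h₃, neg_add, neg_sub]
  rw [neg_add_eq_sub, ← sub_eq_add_neg w w']
  module

theorem torusE_injective [CharZero F] {q : F} {w w' : Fin 2 → ℤ}
    (h : torusE q w = torusE q w') : w = w' ∨ w = -w' := by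
  by_contra! hne
  have h0 := congrArg (fun f => f (Finsupp.single 0 1) w) h
  have hs : ∀ z, symp z 0 = 0 := fun z => by simp [symp]
  simp only [torusE, LinearMap.add_apply, torusX_single, hs, add_zero, zpow_zero,
    Finsupp.add_apply, Finsupp.single_eq_same, Finsupp.single_eq_of_ne hne.1,
    Finsupp.single_eq_of_ne hne.2] at h0
  -- If `w = -w` the coefficient compared with 0 is 2 rather than 1; characteristic zero enters
  -- here.
  by_cases hw : w = -w
  · rw [← hw, Finsupp.single_eq_same] at h0
    norm_num at h0
  · rw [Finsupp.single_eq_of_ne hw] at h0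
    norm_num at h0

/-- The words in `torusE q u`, `torusE q v` of degree two in the former. -/
theorem torusE_words {q : F} (hq : q ≠ 0) {u v : Fin 2 → ℤ} (h : symp u v = 1) :
    (torusE q u ^ 2 * torusE q v = q ^ 2 • torusE q (2 • u + v) + (2 : F) • torusE q v +
      q⁻¹ ^ 2 • torusE q (v - 2 • u)) ∧
    (torusE q u * torusE q v * torusE q u = torusE q (2 • u + v) +
      (q ^ 2 + q⁻¹ ^ 2) • torusE q v + torusE q (v - 2 • u)) ∧
    (torusE q v * torusE q u ^ 2 = q⁻¹ ^ 2 • torusE q (2 • u + v) + (2 : F) • torusE q v +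
      q ^ 2 • torusE q (v - 2 • u)) := by
  have s : u 1 * v 0 - u 0 * v 1 = 1 := h
  have s₁ : symp v u = -1 := by simp only [symp]; linarith
  have s₂ : symp u (u + v) = 1 := by simp only [symp, Pi.add_apply]; linarith
  have s₃ : symp u (v - u) = 1 := by simp only [symp, Pi.sub_apply]; linarith
  have s₄ : symp (u + v) u = -1 := by simp only [symp, Pi.add_apply]; linarith
  have s₅ : symp (v - u) u = -1 := by simp only [symp, Pi.sub_apply]; linarith
  have ab : torusE q u * torusE q v = q • torusE q (u + v) + q⁻¹ • torusE q (v - u) := by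
    rw [torusE_mul hq, h]; simp
  have ba : torusE q v * torusE q u = q⁻¹ • torusE q (u + v) + q • torusE q (v - u) := by
    rw [torusE_mul hq, s₁, ← torusE_neg q (u - v), neg_sub, add_comm v u]; simp
  have ac : torusE q u * torusE q (u + v) = q • torusE q (2 • u + v) + q⁻¹ • torusE q v := by
    rw [torusE_mul hq, s₂, add_sub_cancel_left, ← add_assoc, ← two_smul ℕ u]; simp
  have ad : torusE q u * torusE q (v - u) = q • torusE q v + q⁻¹ • torusE q (v - 2 • u) := by
    rw [torusE_mul hq, s₃, add_sub_cancel, sub_sub, ← two_smul ℕ u]; simp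
  have ca : torusE q (u + v) * torusE q u = q⁻¹ • torusE q (2 • u + v) + q • torusE q v := by
    rw [torusE_mul hq, s₄, ← torusE_neg q (u - (u + v)), neg_sub, add_sub_cancel_left,
      add_comm (u + v), ← add_assoc, ← two_smul ℕ u]; simp
  have da : torusE q (v - u) * torusE q u = q⁻¹ • torusE q v + q • torusE q (v - 2 • u) := by
    rw [torusE_mul hq, s₅, ← torusE_neg q (u - (v - u)), neg_sub, sub_add_cancel, sub_sub,
      ← two_smul ℕ u]; simp
  refine ⟨?_, ?_, ?_⟩
  · rw [sq, mul_assoc, ab, mul_add, mul_smul_comm, mul_smul_comm, ac, ad]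
    match_scalars <;> field_simp
    norm_num
  · rw [ab, add_mul, smul_mul_assoc, smul_mul_assoc, ca, da]
    match_scalars <;> field_simp
  · rw [sq, ← mul_assoc, ba, add_mul, smul_mul_assoc, smul_mul_assoc, ca, da]
    match_scalars <;> field_simp
    norm_num

/-- The q-Dolan/Grady relation is the commutator with `a` of this relation of lower degree, which is
what the torus satisfies. -/
theorem dolanGrady_eq_zero {q : F} (hq : q ≠ 0) (hroot : ∀ n : ℕ, 0 < n → q ^ n ≠ 1)
    {R : Type*} [Ring R] [Algebra F R] {a b : R}
    (h : a ^ 2 * b - (q ^ 2 + q⁻¹ ^ 2) • (a * b * a) + b * a ^ 2 =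
      -(q ^ 2 - q⁻¹ ^ 2) ^ 2 • b) : dolanGrady q a b = 0 := by
  have e : dolanGrady q a b =
      a * (a ^ 2 * b - (q ^ 2 + q⁻¹ ^ 2) • (a * b * a) + b * a ^ 2) -
        (a ^ 2 * b - (q ^ 2 + q⁻¹ ^ 2) • (a * b * a) + b * a ^ 2) * a +
        (q ^ 2 - q⁻¹ ^ 2) ^ 2 • (a * b - b * a) := by
    rw [dolanGrady, qInt_three hq hroot]
    simp only [pow_succ, pow_zero, one_mul, mul_add, mul_sub, add_mul, sub_mul, mul_assoc,
      mul_smul_comm, smul_mul_assoc]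
    module
  rw [e, h]
  simp only [mul_smul_comm, smul_mul_assoc]
  module

theorem dolanGrady_torusE {q : F} (hq : q ≠ 0) (hroot : ∀ n : ℕ, 0 < n → q ^ n ≠ 1)
    {u v : Fin 2 → ℤ} (h : symp u v = 1) : dolanGrady q (torusE q u) (torusE q v) = 0 := by
  obtain ⟨h₁, h₂, h₃⟩ := torusE_words hq h
  refine dolanGrady_eq_zero hq hroot ?_
  rw [h₁, h₂, h₃]
  match_scalars <;> field_simp <;> ring

/-- The combination in `bkImage` cancels the `E_{v-2u}` terms and leaves a multiple of `E_{2u+v} -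
E_v`; the normalising denominator is exactly that multiple, so `bkImage` acts on the lattice as a
transvection. -/
theorem bkImage_torusE {q : F} (hq : q ≠ 0) (hroot : ∀ n : ℕ, 0 < n → q ^ n ≠ 1)
    {u v : Fin 2 → ℤ} (h : symp u v = 1) :
    bkImage q (torusE q u) (torusE q v) = torusE q (2 • u + v) := by
  obtain ⟨h₁, h₂, h₃⟩ := torusE_words hq h
  have hk : (q - q⁻¹) * (q ^ 2 - q⁻¹ ^ 2) ≠ 0 :=
    mul_ne_zero (sub_inv_ne_zero hq hroot) (sq_sub_inv_sq_ne_zero hq hroot)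
  have e : q • (q ^ 2 • torusE q (2 • u + v) + (2 : F) • torusE q v +
      q⁻¹ ^ 2 • torusE q (v - 2 • u)) - (q + q⁻¹) • (torusE q (2 • u + v) +
      (q ^ 2 + q⁻¹ ^ 2) • torusE q v + torusE q (v - 2 • u)) +
      q⁻¹ • (q⁻¹ ^ 2 • torusE q (2 • u + v) + (2 : F) • torusE q v +
      q ^ 2 • torusE q (v - 2 • u)) =
      ((q - q⁻¹) * (q ^ 2 - q⁻¹ ^ 2)) • (torusE q (2 • u + v) - torusE q v) := by
    match_scalars <;> field_simp <;> ring
  rw [bkImage, h₁, h₂, h₃, e, inv_smul_smul₀ hk]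
  exact add_sub_cancel (torusE q v) (torusE q (2 • u + v))

end QuantumTorus

end QOnsager

namespace QOnsager

/-! ### The torus representation of `O_q` and freeness of `T₀, T₁` -/

theorem Onsager.induction {F : Type*} [Field F] {q : F} {p : Onsager q → Prop}
    (hA : p (Onsager.A q)) (hB : p (Onsager.B q)) (hc : ∀ c : F, p (algebraMap F _ c))
    (hadd : ∀ x y, p x → p y → p (x + y)) (hmul : ∀ x y, p x → p y → p (x * y))
    (x : Onsager q) : p x := by
  obtain ⟨y, rfl⟩ := RingQuot.mkAlgHom_surjective F (OnsagerRel q) x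
  change p (Onsager.mk q y)
  induction y using FreeAlgebra.induction with
  | grade0 r => rw [AlgHom.commutes]; exact hc r
  | grade1 i =>
    fin_cases i
    · exact hA
    · exact hB
  | mul a b ha hb => rw [map_mul]; exact hmul _ _ ha hb
  | add a b ha hb => rw [map_add]; exact hadd _ _ ha hb

section TorusAction

open Matrix

variable {F : Type*} [Field F] {q : F}

/-- The action of `SL₂(ℤ)` on `ℤ²`. -/
def latticeAct (g : SL(2, ℤ)) (w : Fin 2 → ℤ) : Fin 2 → ℤ :=
  ![g 0 0 * w 0 + g 0 1 * w 1, g 1 0 * w 0 + g 1 1 * w 1]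

theorem latticeAct_apply (g : SL(2, ℤ)) (w : Fin 2 → ℤ) (i : Fin 2) :
    latticeAct g w i = g i 0 * w 0 + g i 1 * w 1 := by
  fin_cases i <;> rfl

theorem latticeAct_add (g : SL(2, ℤ)) (w z : Fin 2 → ℤ) :
    latticeAct g (w + z) = latticeAct g w + latticeAct g z := by
  ext i
  simp only [latticeAct_apply, Pi.add_apply]
  ring

theorem latticeAct_neg (g : SL(2, ℤ)) (w : Fin 2 → ℤ) :
    latticeAct g (-w) = -latticeAct g w := by
  ext i
  simp only [latticeAct_apply, Pi.neg_apply]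
  ring

theorem latticeAct_one (w : Fin 2 → ℤ) : latticeAct 1 w = w := by
  ext i
  rw [latticeAct_apply]
  fin_cases i <;> simp

theorem latticeAct_mul (g h : SL(2, ℤ)) (w : Fin 2 → ℤ) :
    latticeAct (g * h) w = latticeAct g (latticeAct h w) := by
  ext i
  simp only [latticeAct_apply, SL2_mul_apply]
  ring

theorem symp_latticeAct (g : SL(2, ℤ)) (w z : Fin 2 → ℤ) :
    symp (latticeAct g w) (latticeAct g z) = symp w z := by
  have hdet : g 0 0 * g 1 1 - g 0 1 * g 1 0 = 1 := by
    rw [← Matrix.det_fin_two, g.det_coe]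
  simp only [symp, latticeAct_apply]
  linear_combination (w 1 * z 0 - w 0 * z 1) * hdet

theorem latticeAct_U (n : ℤ) (a b : ℤ) : latticeAct (U n) ![a, b] = ![a + n * b, b] := by
  obtain ⟨h₀, h₁, h₂, h₃⟩ := U_apply n
  rw [latticeAct, h₀, h₁, h₂, h₃]
  simp

theorem latticeAct_L (n : ℤ) (a b : ℤ) : latticeAct (L n) ![a, b] = ![a, n * a + b] := by
  obtain ⟨h₀, h₁, h₂, h₃⟩ := L_apply n
  rw [latticeAct, h₀, h₁, h₂, h₃]
  simp

/-- The operator permuting the basis indexed by `ℤ²` through an element of `SL₂(ℤ)`. -/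
noncomputable def torusPerm (F : Type*) [Field F] (g : SL(2, ℤ)) :
    Module.End F ((Fin 2 → ℤ) →₀ F) :=
  Finsupp.lmapDomain F F (latticeAct g)

theorem torusPerm_single (g : SL(2, ℤ)) (z : Fin 2 → ℤ) (c : F) :
    torusPerm F g (Finsupp.single z c) = Finsupp.single (latticeAct g z) c := by
  simp [torusPerm]

theorem torusPerm_mul (g h : SL(2, ℤ)) :
    torusPerm F g * torusPerm F h = torusPerm F (g * h) := by
  ext z : 2
  simp only [LinearMap.comp_apply, Module.End.mul_apply, Finsupp.lsingle_apply, torusPerm_single,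
    latticeAct_mul]

theorem torusPerm_one : torusPerm F 1 = 1 := by
  ext z : 2
  simp only [LinearMap.comp_apply, Finsupp.lsingle_apply, torusPerm_single, latticeAct_one,
    Module.End.one_apply]

theorem torusX_mul_torusPerm (g : SL(2, ℤ)) (w : Fin 2 → ℤ) :
    torusX q (latticeAct g w) * torusPerm F g = torusPerm F g * torusX q w := by
  ext z : 2
  simp only [LinearMap.comp_apply, Module.End.mul_apply, Finsupp.lsingle_apply, torusPerm_single,
    torusX_single, symp_latticeAct, latticeAct_add]

theorem torusE_mul_torusPerm (g : SL(2, ℤ)) (w : Fin 2 → ℤ) :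
    torusE q (latticeAct g w) * torusPerm F g = torusPerm F g * torusE q w := by
  rw [torusE, torusE, add_mul, mul_add, torusX_mul_torusPerm, ← latticeAct_neg,
    torusX_mul_torusPerm]

theorem exists_torusRep (hq : q ≠ 0) (hroot : ∀ n : ℕ, 0 < n → q ^ n ≠ 1) :
    ∃ π : Onsager q →ₐ[F] Module.End F ((Fin 2 → ℤ) →₀ F),
      π (Onsager.A q) = torusE q ![1, 0] ∧ π (Onsager.B q) = torusE q ![0, 1] := by
  have h₁ : dolanGrady q (torusE q ![1, 0]) (torusE q ![0, 1]) = 0 := by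
    -- `symp ![1, 0] ![0, 1]` is `-1`; replacing `(0, 1)` by its negative leaves `torusE` unchanged
    -- and makes the form equal to 1.
    rw [← torusE_neg q ![0, 1]]
    exact dolanGrady_torusE hq hroot (by simp [symp])
  have h₂ : dolanGrady q (torusE q ![0, 1]) (torusE q ![1, 0]) = 0 :=
    dolanGrady_torusE hq hroot (by simp [symp])
  exact ⟨Onsager.lift h₁ h₂, Onsager.lift_A h₁ h₂, Onsager.lift_B h₁ h₂⟩

/-- `T` acts in a representation `π` as conjugation by the permutation operator of `g`. -/
def Intertwines (π : Onsager q →ₐ[F] Module.End F ((Fin 2 → ℤ) →₀ F))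
    (T : Onsager q ≃ₐ[F] Onsager q) (g : SL(2, ℤ)) : Prop :=
  ∀ x, π (T x) * torusPerm F g = torusPerm F g * π x

theorem Intertwines.of_generators {π : Onsager q →ₐ[F] Module.End F ((Fin 2 → ℤ) →₀ F)}
    {T : Onsager q ≃ₐ[F] Onsager q} {g : SL(2, ℤ)}
    (hA : π (T (Onsager.A q)) * torusPerm F g = torusPerm F g * π (Onsager.A q))
    (hB : π (T (Onsager.B q)) * torusPerm F g = torusPerm F g * π (Onsager.B q)) :
    Intertwines π T g := by
  intro x
  induction x using Onsager.induction with
  | hA => exact hA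
  | hB => exact hB
  | hc c =>
    rw [AlgEquiv.commutes, AlgHom.commutes]
    exact Algebra.commutes c _
  | hadd x y hx hy => rw [map_add, map_add, map_add, add_mul, mul_add, hx, hy]
  | hmul x y hx hy => rw [map_mul, map_mul, map_mul, mul_assoc, hy, ← mul_assoc, hx, mul_assoc]

theorem Intertwines.one (π : Onsager q →ₐ[F] Module.End F ((Fin 2 → ℤ) →₀ F)) :
    Intertwines π 1 1 := by
  intro x
  rw [torusPerm_one, AlgEquiv.one_apply, mul_one, one_mul]

theorem Intertwines.mul {π : Onsager q →ₐ[F] Module.End F ((Fin 2 → ℤ) →₀ F)}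
    {T T' : Onsager q ≃ₐ[F] Onsager q} {g g' : SL(2, ℤ)} (h : Intertwines π T g)
    (h' : Intertwines π T' g') : Intertwines π (T * T') (g * g') := by
  intro x
  rw [AlgEquiv.mul_apply, ← torusPerm_mul, ← mul_assoc, h, mul_assoc, h', mul_assoc]

theorem Intertwines.inv {π : Onsager q →ₐ[F] Module.End F ((Fin 2 → ℤ) →₀ F)}
    {T : Onsager q ≃ₐ[F] Onsager q} {g : SL(2, ℤ)} (h : Intertwines π T g) :
    Intertwines π T⁻¹ g⁻¹ := by
  intro x
  obtain ⟨y, rfl⟩ := T.surjective x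
  have e : T⁻¹ (T y) = y := T.symm_apply_apply y
  have e₁ : torusPerm F g⁻¹ * torusPerm F g = 1 := by
    rw [torusPerm_mul, inv_mul_cancel, torusPerm_one]
  have e₂ : torusPerm F g * torusPerm F g⁻¹ = 1 := by
    rw [torusPerm_mul, mul_inv_cancel, torusPerm_one]
  calc π (T⁻¹ (T y)) * torusPerm F g⁻¹
      = torusPerm F g⁻¹ * (torusPerm F g * π y) * torusPerm F g⁻¹ := by
        rw [e, ← mul_assoc, e₁, one_mul]
    _ = torusPerm F g⁻¹ * π (T y) := by rw [← h y, mul_assoc, mul_assoc, e₂, mul_one]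

/-- If the identity automorphism is implemented by `g`, conjugation by `g` fixes `E_w`, and `E_w`
determines `w` up to sign. -/
theorem Intertwines.latticeAct_eq [CharZero F]
    {π : Onsager q →ₐ[F] Module.End F ((Fin 2 → ℤ) →₀ F)} {g : SL(2, ℤ)}
    (h : Intertwines π 1 g) {x : Onsager q} {w : Fin 2 → ℤ} (hx : π x = torusE q w) :
    w = latticeAct g w ∨ w = -latticeAct g w := by
  have e := h x
  rw [AlgEquiv.one_apply, hx, ← torusE_mul_torusPerm] at e
  have e₂ : torusPerm F g * torusPerm F g⁻¹ = 1 := by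
    rw [torusPerm_mul, mul_inv_cancel, torusPerm_one]
  have e' := congrArg (· * torusPerm F g⁻¹) e
  simp only [mul_assoc, e₂, mul_one] at e'
  exact torusE_injective e'

theorem lift_T₀_T₁_injective [CharZero F] (hq : q ≠ 0) (hroot : ∀ n : ℕ, 0 < n → q ^ n ≠ 1)
    {T₀ T₁ : Onsager q ≃ₐ[F] Onsager q} (hT : IsBaseilhacKolb q T₀ T₁) :
    Function.Injective (FreeGroup.lift ![T₀, T₁]) := by
  obtain ⟨π, πA, πB⟩ := exists_torusRep hq hroot
  have h₀ : Intertwines π T₀ (U (-2)) := by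
    have e : bkImage q (torusE q ![1, 0]) (torusE q ![0, 1]) = torusE q ![-2, 1] := by
      rw [← torusE_neg q ![0, 1], bkImage_torusE hq hroot (by simp [symp]), ← torusE_neg]
      simp
    refine .of_generators ?_ ?_
    · rw [hT.T₀_A, πA, ← torusE_mul_torusPerm, latticeAct_U]
      simp
    · have e' := map_bkImage (q := q) (S := Module.End F ((Fin 2 → ℤ) →₀ F)) π
        (Onsager.A q) (Onsager.B q)
      rw [πA, πB, e] at e'
      rw [hT.T₀_B, e', πB, ← torusE_mul_torusPerm, latticeAct_U]
      simp
  have h₁ : Intertwines π T₁ (L 2) := by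
    have e : bkImage q (torusE q ![0, 1]) (torusE q ![1, 0]) = torusE q ![1, 2] := by
      rw [bkImage_torusE hq hroot (by simp [symp])]
      simp
    refine .of_generators ?_ ?_
    · have e' := map_bkImage (q := q) (S := Module.End F ((Fin 2 → ℤ) →₀ F)) π
        (Onsager.B q) (Onsager.A q)
      rw [πA, πB, e] at e'
      rw [hT.T₁_A, e', πA, ← torusE_mul_torusPerm, latticeAct_L]
      simp
    · rw [hT.T₁_B, πB, ← torusE_mul_torusPerm, latticeAct_L]
      simp
  -- The words are followed in `SL₂(ℤ)`, since `PSL₂(ℤ)` acts on the lattice only up to sign; the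
  -- sign is dropped at the end through `toPSL`.
  have word : ∀ w : FreeGroup (Fin 2),
      Intertwines π (FreeGroup.lift ![T₀, T₁] w) (FreeGroup.lift ![U (-2), L 2] w) := by
    intro w
    induction w using FreeGroup.induction_on with
    | C1 => rw [map_one, map_one]; exact .one π
    | of i =>
      rw [FreeGroup.lift_apply_of, FreeGroup.lift_apply_of]
      fin_cases i
      · exact h₀
      · exact h₁
    | inv_of i ih => rw [map_inv, map_inv]; exact ih.inv
    | mul x y hx hy => rw [map_mul, map_mul]; exact hx.mul hy
  have hlift : toPSL.comp (FreeGroup.lift ![U (-2), L 2]) = FreeGroup.lift ![t₀, t₁] := by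
    ext i
    fin_cases i
    · simp [t₀_eq]
    · simp [t₁_eq]
  rw [injective_iff_map_eq_one]
  intro w hw
  have hfix := word w
  rw [hw] at hfix
  apply lift_t₀_t₁_injective
  rw [map_one, ← hlift, MonoidHom.comp_apply]
  generalize FreeGroup.lift ![U (-2), L 2] w = g at hfix
  have hdet : g 0 0 * g 1 1 - g 0 1 * g 1 0 = 1 := by
    rw [← Matrix.det_fin_two, g.det_coe]
  have e₀ : ∀ i, latticeAct g ![1, 0] i = g i 0 := fun i => by simp [latticeAct_apply]
  have e₁ : ∀ i, latticeAct g ![0, 1] i = g i 1 := fun i => by simp [latticeAct_apply]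
  have hA : g 1 0 = 0 ∧ (g 0 0 = 1 ∨ g 0 0 = -1) := by
    rcases hfix.latticeAct_eq πA with h | h
    · have a := congrFun h 0
      have b := congrFun h 1
      simp [e₀] at a b
      omega
    · have a := congrFun h 0
      have b := congrFun h 1
      simp [e₀] at a b
      omega
  have hB : g 0 1 = 0 ∧ (g 1 1 = 1 ∨ g 1 1 = -1) := by
    rcases hfix.latticeAct_eq πB with h | h
    · have a := congrFun h 0
      have b := congrFun h 1
      simp [e₁] at a b
      omega
    · have a := congrFun h 0
      have b := congrFun h 1
      simp [e₁] at a b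
      omega
  rw [← map_one toPSL, toPSL_eq_iff]
  have hneg : ∀ (h : SL(2, ℤ)) (i j : Fin 2), (-h) i j = -(h i j) := fun _ _ _ => rfl
  have h1 : (1 : SL(2, ℤ)) 0 0 = 1 ∧ (1 : SL(2, ℤ)) 0 1 = 0 ∧ (1 : SL(2, ℤ)) 1 0 = 0 ∧
    (1 : SL(2, ℤ)) 1 1 = 1 := ⟨rfl, rfl, rfl, rfl⟩
  obtain ⟨i₀, i₁, i₂, i₃⟩ := h1
  obtain ⟨hc, ha⟩ := hA
  obtain ⟨hb, hd⟩ := hB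
  rw [hb, hc] at hdet
  rcases ha with ha | ha
  · left
    rw [ha] at hdet
    exact SL2_ext (by omega) (by omega) (by omega) (by omega)
  · right
    rw [ha] at hdet
    exact SL2_ext (by rw [hneg]; omega) (by rw [hneg]; omega) (by rw [hneg]; omega)
      (by rw [hneg]; omega)

end TorusAction

end QOnsager

namespace QOnsager

/-! ### Assembly of the main theorem -/

theorem closure_range_eq_bkGroup {F : Type*} [Field F] {q : F}
    (T₀ T₁ : Onsager q ≃ₐ[F] Onsager q) :
    Subgroup.closure (Set.range ![T₀, T₁]) = bkGroup T₀ T₁ := by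
  rw [Matrix.range_cons_cons_empty, bkGroup]
  apply le_antisymm
  · refine Subgroup.closure_mono ?_
    rintro _ (rfl | rfl) <;> simp
  · rw [Subgroup.closure_le]
    have h₀ : T₀ ∈ Subgroup.closure {T₀, T₁} := Subgroup.subset_closure (by simp)
    have h₁ : T₁ ∈ Subgroup.closure {T₀, T₁} := Subgroup.subset_closure (by simp)
    rintro _ (rfl | rfl | rfl | rfl)
    · exact h₀
    · exact inv_mem h₀
    · exact h₁
    · exact inv_mem h₁

end QOnsager

theorem mainTheorem4 {F : Type*} [Field F] [IsAlgClosed F] [CharZero F] (q : F) (hq : q ≠ 0)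
    (hq_root : ∀ n : ℕ, 0 < n → q ^ n ≠ 1) :
    (∃! T : (QOnsager.Onsager q ≃ₐ[F] QOnsager.Onsager q) ×
        (QOnsager.Onsager q ≃ₐ[F] QOnsager.Onsager q), QOnsager.IsBaseilhacKolb q T.1 T.2) ∧
    (∃! Φ : Matrix.ProjectiveSpecialLinearGroup (Fin 2) ℤ →*
        (QOnsager.AskeyWilson q ≃ₐ[F] QOnsager.AskeyWilson q), QOnsager.IsModularAction q Φ) ∧
    ∀ (T₀ T₁ : QOnsager.Onsager q ≃ₐ[F] QOnsager.Onsager q)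
      (Φ : Matrix.ProjectiveSpecialLinearGroup (Fin 2) ℤ →*
        (QOnsager.AskeyWilson q ≃ₐ[F] QOnsager.AskeyWilson q)),
      QOnsager.IsBaseilhacKolb q T₀ T₁ → QOnsager.IsModularAction q Φ →
      -- `G` is freely generated by `T₀`, `T₁`
      (∃ b : FreeGroupBasis (Fin 2) (QOnsager.bkGroup T₀ T₁),
        (b 0 : QOnsager.Onsager q ≃ₐ[F] QOnsager.Onsager q) = T₀ ∧
        (b 1 : QOnsager.Onsager q ≃ₐ[F] QOnsager.Onsager q) = T₁) ∧
      -- `ρ` and `σ` permute `α`, `β`, `γ`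
      (Φ QOnsager.ρ (QOnsager.AskeyWilson.α q) = QOnsager.AskeyWilson.β q ∧
        Φ QOnsager.ρ (QOnsager.AskeyWilson.β q) = QOnsager.AskeyWilson.γ q ∧
        Φ QOnsager.ρ (QOnsager.AskeyWilson.γ q) = QOnsager.AskeyWilson.α q ∧
        Φ QOnsager.σ (QOnsager.AskeyWilson.α q) = QOnsager.AskeyWilson.β q ∧
        Φ QOnsager.σ (QOnsager.AskeyWilson.β q) = QOnsager.AskeyWilson.α q ∧
        Φ QOnsager.σ (QOnsager.AskeyWilson.γ q) = QOnsager.AskeyWilson.γ q) ∧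
      -- `ℙ` is the image of `Γ(2)` in `PSL₂(ℤ)`, and it is freely generated by `t₀`, `t₁`
      QOnsager.modularKernel Φ = (CongruenceSubgroup.Gamma 2).map
        (QuotientGroup.mk' (Subgroup.center (Matrix.SpecialLinearGroup (Fin 2) ℤ))) ∧
      (∃ b : FreeGroupBasis (Fin 2) (QOnsager.modularKernel Φ),
        (b 0 : Matrix.ProjectiveSpecialLinearGroup (Fin 2) ℤ) = QOnsager.t₀ ∧
        (b 1 : Matrix.ProjectiveSpecialLinearGroup (Fin 2) ℤ) = QOnsager.t₁) ∧
      -- the map `ε : ℙ → G` with `t₀ ↦ T₀`, `t₁ ↦ T₁` is an isomorphism of groups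
      ∃ (h₀ : QOnsager.t₀ ∈ QOnsager.modularKernel Φ) (h₁ : QOnsager.t₁ ∈ QOnsager.modularKernel Φ)
        (ε : QOnsager.modularKernel Φ ≃* QOnsager.bkGroup T₀ T₁),
        (ε ⟨QOnsager.t₀, h₀⟩ : QOnsager.Onsager q ≃ₐ[F] QOnsager.Onsager q) = T₀ ∧
        (ε ⟨QOnsager.t₁, h₁⟩ : QOnsager.Onsager q ≃ₐ[F] QOnsager.Onsager q) = T₁ := by
  refine ⟨QOnsager.existsUnique_isBaseilhacKolb hq hq_root,
    QOnsager.existsUnique_isModularAction hq hq_root, fun T₀ T₁ Φ hT hΦ => ?_⟩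
  have hker := QOnsager.modularKernel_eq hq hq_root hΦ
  obtain ⟨b, hb⟩ := QOnsager.exists_freeGroupBasis
    (QOnsager.lift_T₀_T₁_injective hq hq_root hT) (QOnsager.closure_range_eq_bkGroup T₀ T₁)
  obtain ⟨c, hc⟩ := QOnsager.exists_freeGroupBasis QOnsager.lift_t₀_t₁_injective
    (QOnsager.closure_t₀_t₁.trans hker.symm)
  have hc₀ : (c 0 : Matrix.ProjectiveSpecialLinearGroup (Fin 2) ℤ) = QOnsager.t₀ := hc 0
  have hc₁ : (c 1 : Matrix.ProjectiveSpecialLinearGroup (Fin 2) ℤ) = QOnsager.t₁ := hc 1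
  -- `ε` is the composite of the identifications of `ℙ` and `G` with the free group on two letters.
  refine ⟨⟨b, hb 0, hb 1⟩, hΦ.map_central hq hq_root, hker, ⟨c, hc₀, hc₁⟩,
    hc₀ ▸ (c 0).2, hc₁ ▸ (c 1).2, c.repr.trans b.repr.symm, ?_, ?_⟩
  · have e : (⟨QOnsager.t₀, hc₀ ▸ (c 0).2⟩ : QOnsager.modularKernel Φ) = c 0 :=
      Subtype.ext hc₀.symm
    rw [e, MulEquiv.trans_apply, FreeGroupBasis.repr_apply_coe]
    exact hb 0
  · have e : (⟨QOnsager.t₁, hc₁ ▸ (c 1).2⟩ : QOnsager.modularKernel Φ) = c 1 :=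
      Subtype.ext hc₁.symm
    rw [e, MulEquiv.trans_apply, FreeGroupBasis.repr_apply_coe]
    exact hb 1
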